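/- **Setting.** Let $\xi$ be a complex random variable with $\mathbb E\,\xi=0$, $\mathbb E|\xi|^2=1$ and $\mathbb E|\xi|^q<\infty$ for all $q\in\mathbb N$; put $m_4=\mathbb E|\xi|^4$. Let $k=k(n)$ and $m=m(n)$ be sequences of natural numbers with $$\frac{k}{n}\to d,\qquad \frac{m}{n^k}\to c\qquad (n\to\infty),\qquad c,d\in(0,\infty).$$ For every $n$ let $\xi^{(l)}_{\alpha,i}$ ($1\le\alpha\le m$, $1\le l\le k$, $1\le i\le n$) be i.i.d. copies of $\xi$, all defined on one probability space, with an arbitrary joint distribution for different $n$. Put $\mathbf y^{(l)}_\alpha=n^{-1/2}(\xi^{(l)}_{\alpha,1},\dots,\xi^{(l)}_{\alpha,n})\in\mathbb C^n$ and $Y_\alpha=\mathbf y^{(1)}_\alpha\otimes\cdots\otimes\mathbf y^{(k)}_\alpha$. Let $\tau_1,\tau_2,\dots$ be real numbers such that for every integer $q\ge1$ the limit $m^{(\tau)}_q=\lim_{N\to\infty}\frac1N\sum_{j=1}^N\tau_j^q$ exists and is finite. Consider the $n^k\times n^k$ Hermitian matrix $M_n=\sum_{\alpha=1}^m\tau_\alpha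 Y_\alpha Y_\alpha^*$. **Combinatorial notation.** A sequence $\alpha=(\alpha_1,\dots,\alpha_p)$ of positive integers is a *canonical $s$-sequence* of length $p$ if its set of values is $\{1,\dots,s\}$, $\alpha_1=1$, and $\alpha_u\le\max(\alpha_1,\dots,\alpha_{u-1})+1$ for $u\ge2$. Let $\deg_t(\alpha)=|\{j:\alpha_j=t\}|$. For a canonical $s$-sequence $\alpha$ and a canonical $r$-sequence $i$, both of length $p$, let $g(i,\alpha)$ be the bipartite multigraph with $s$ $\alpha$-vertices and $r$ $i$-vertices that has a down edge from $\alpha_u$ to $i_u$ and an up edge from $i_u$ to $\alpha_{u+1}$ for $1\le u\le p$, where $\alpha_{p+1}=\alpha_1$. Edges with the same endpoints are said to coincide, whatever their orientation. Let $\mathcal C^{(1)}_{s,p}$ be the set of canonical $s$-sequences $\alpha$ of length $p$ for which there is a canonical $(p+1-s)$-sequence $i$ of length $p$ such that in $g(i,\alpha)$ each down edge coincides with exactly one up edge, and gluing the coincident edges gives a tree with $p$ edges and $p+1$ vertices. **Theorem.** For every integer $p\ge1$, the random variables $n^{-k}\operatorname{Tr}M_n^p$ are square-integrable and: 1. $$\lim_{n\to\infty}\frac1{n^k}\mathbb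 E\big[\operatorname{Tr}M_n^p\big]=\gamma_p:=\sum_{s=1}^p c^s\sum_{\alpha\in\mathcal C^{(1)}_{s,p}}\Big(\prod_{t=1}^s m^{(\tau)}_{\deg_t(\alpha)}\Big)\exp\Big(d(m_4-1)\sum_{t=1}^s\binom{\deg_t(\alpha)}{2}\Big).$$ 2. $$\sum_{n=1}^\infty\operatorname{Var}\Big(\frac1{n^k}\operatorname{Tr}M_n^p\Big)<\infty.$$ 3. $n^{-k}\operatorname{Tr}M_n^p\to\gamma_p$ almost surely as $n\to\infty$. -/

import Mathlib

open MeasureTheory ProbabilityTheory Filter Topology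

namespace TensorCovariance

/-! ### The random matrix -/

/-- The `α`-th column `Y_α = y_α^(1) ⊗ ⋯ ⊗ y_α^(k)`, with `y_α^(l) = (x α l 1, …, x α l n) / √n`.
The coordinates of `(ℂ^n)^{⊗ k}` are labelled by multi-indices `i : Fin k → Fin n`. -/
noncomputable def tensorColumn {n k m : ℕ} (x : Fin m → Fin k → Fin n → ℂ) (α : Fin m) :
    (Fin k → Fin n) → ℂ :=
  fun i => ∏ l : Fin k, x α l (i l) / (Real.sqrt n : ℂ)

/-- The matrix `M = ∑_α τ_α Y_α Y_α^*`, of size `n ^ k`; the coefficients are `τ 0, …, τ (m - 1)`. -/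
noncomputable def tensorCovMatrix {n k m : ℕ} (τ : ℕ → ℝ) (x : Fin m → Fin k → Fin n → ℂ) :
    Matrix (Fin k → Fin n) (Fin k → Fin n) ℂ :=
  ∑ α : Fin m, (τ α : ℂ) • Matrix.vecMulVec (tensorColumn x α) (star (tensorColumn x α))

/-- The normalized trace moment `n^{-k} Tr M^p`. The trace is real, see `coe_traceMoment`. -/
noncomputable def traceMoment {n k m : ℕ} (τ : ℕ → ℝ) (p : ℕ) (x : Fin m → Fin k → Fin n → ℂ) :
    ℝ :=
  (Matrix.trace (tensorCovMatrix τ x ^ p)).re / (n : ℝ) ^ k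

theorem tensorCovMatrix_isHermitian {n k m : ℕ} (τ : ℕ → ℝ) (x : Fin m → Fin k → Fin n → ℂ) :
    (tensorCovMatrix τ x).IsHermitian := by
  unfold Matrix.IsHermitian tensorCovMatrix
  rw [Matrix.conjTranspose_sum]
  refine Finset.sum_congr rfl fun α _ => ?_
  ext i j
  simp [Matrix.vecMulVec_apply, mul_comm]

/-- Taking the real part in `traceMoment` loses nothing. -/
theorem coe_traceMoment {n k m : ℕ} (τ : ℕ → ℝ) (p : ℕ) (x : Fin m → Fin k → Fin n → ℂ) :
    (traceMoment τ p x : ℂ) = Matrix.trace (tensorCovMatrix τ x ^ p) / (n : ℂ) ^ k := by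
  have h : star (Matrix.trace (tensorCovMatrix τ x ^ p)) =
      Matrix.trace (tensorCovMatrix τ x ^ p) := by
    rw [← Matrix.trace_conjTranspose, ((tensorCovMatrix_isHermitian τ x).pow p).eq]
  have h2 : ((Matrix.trace (tensorCovMatrix τ x ^ p)).re : ℂ) =
      Matrix.trace (tensorCovMatrix τ x ^ p) := Complex.conj_eq_iff_re.mp h
  unfold traceMoment
  push_cast
  rw [h2]

/-! ### Canonical sequences and their graphs -/

/-- A canonical `s`-sequence of length `p`, with the `s` values numbered from `0`: every value
occurs, the first term is `0`, and each later term exceeds the maximum of the preceding terms by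
at most one. (The supremum over the empty set is `0`.) -/
def IsCanonical {p s : ℕ} (α : Fin p → Fin s) : Prop :=
  Function.Surjective α ∧
    ∀ u : Fin p, (α u : ℕ) ≤ (Finset.univ.filter fun v : Fin p => v < u).sup
      fun v => (α v : ℕ) + 1

/-- `deg_t(α)`, the number of occurrences of `t` in `α`. -/
def deg {p s : ℕ} (α : Fin p → Fin s) (t : Fin s) : ℕ :=
  (Finset.univ.filter fun j : Fin p => α j = t).card

/-- The bipartite multigraph `g(i, α)` has a down edge from `α_u` to `i_u` and an up edge from
`i_u` to `α_{u+1}` for every `u`, with indices modulo `p` (`finRotate p u` is `u + 1` modulo `p`).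
This is the simple graph obtained from it by forgetting the orientations and gluing the edges
that have the same endpoints. -/
def gluedGraph {p s r : ℕ} (α : Fin p → Fin s) (i : Fin p → Fin r) :
    SimpleGraph (Fin s ⊕ Fin r) :=
  SimpleGraph.fromRel fun v w =>
    ∃ u : Fin p, (v = Sum.inl (α u) ∧ w = Sum.inr (i u)) ∨
      (v = Sum.inr (i u) ∧ w = Sum.inl (α (finRotate p u)))

/-- The class `Δ₁`: every down edge coincides with one and only one up edge, and gluing the
coincident edges gives a tree with `p` edges (and `p + 1` vertices). -/
def IsDelta1 {p s r : ℕ} (α : Fin p → Fin s) (i : Fin p → Fin r) : Prop :=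
  (∀ u : Fin p, ∃! v : Fin p, α (finRotate p v) = α u ∧ i v = i u) ∧
    (gluedGraph α i).IsTree ∧ (gluedGraph α i).edgeSet.ncard = p

open Classical in
/-- The set `𝒞⁽¹⁾_{s,p}` of the canonical `s`-sequences `α` of length `p` for which there is a
canonical `(p + 1 - s)`-sequence `i` such that `g(i, α)` belongs to `Δ₁`. -/
noncomputable def canonicalOne (s p : ℕ) : Finset (Fin p → Fin s) :=
  Finset.univ.filter fun α =>
    IsCanonical α ∧ ∃ i : Fin p → Fin (p + 1 - s), IsCanonical i ∧ IsDelta1 α i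

/-- The limiting `p`-th moment, in terms of `c`, `d`, the fourth absolute moment `m₄` of the base
variable and the limits `mτ q` of the empirical moments of the coefficients. -/
noncomputable def limitMoment (c d m₄ : ℝ) (mτ : ℕ → ℝ) (p : ℕ) : ℝ :=
  ∑ s ∈ Finset.Icc 1 p, c ^ s * ∑ α ∈ canonicalOne s p,
    (∏ t : Fin s, mτ (deg α t)) *
      Real.exp (d * (m₄ - 1) * ∑ t : Fin s, ((deg α t).choose 2 : ℝ))

end TensorCovariance

/-! By cyclicity of the trace, $M_n$ may be replaced by an $m\times m$ Gram-type matrix whose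
entries are products over the $k$ tensor factors. Expanding $\operatorname{Tr}M_n^p$ gives a sum
over cyclic words `a : Fin p → Fin m`. As the factors are i.i.d., each word has expectation
$(\mathtt{wordSum}/n^p)^k$, a $k$-th power of a one-factor quantity (`integral_wordProd`). This
depends only on the kernel of `a`, that is on a canonical sequence `α` with $s$ values. Summing the
coefficients over the injections of those values and dividing by $n^{ks}$ produces $c^s\prod_t
m^{(\tau)}_{\deg_t}$.

It remains to find the limit of $(\mathtt{wordSum}/n^{p+1-s})^k$. Since $k\sim dn$, the leading
order does not suffice: the $1/n$ term is needed. A choice `i` of columns contributes only if no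
glued edge is simple. There are then at most $p$ glued edges, and connectedness leaves at most
$p+1-s$ columns. Equality forces a tree whose edges are each used once in each direction. If `α`
admits no such `i`, the quotient is $O(1/n)$ and its power tends to 0.

Otherwise the quotient is $1+(m_4-1)\sum_t\binom{\deg_t}{2}/n+O(n^{-2})$, and its power tends to the
exponential (`IsTreeWord.wordSum_asymptotics`). This is proved by pruning. A tree word contains
either a column used once, which is a loop at some vertex, or a vertex with one arrow in and one
arrow out along the same column. Contracting the latter leaves `wordSum` unchanged. A loop at a
vertex with $\delta$ other outgoing arrows multiplies it by $n+\delta(m_4-1)$ up to a relative error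
$O(n^{-2})$: each of the $n$ columns contributes 1, except that a column already joined to the
vertex turns a double edge into a quadruple one, of weight $m_4$. The numbers $\delta$ add up to the
binomials.

For the variance, pairs of words without common vertex have covariance zero. A common vertex makes
the pair connected, so that a pair with $s$ vertices in all has covariance $O((Ln\cdot n^{-s})^k)$
(`norm_wordSum_sub_le`). Summation gives $\operatorname{Var}\le 2C(L/n)^k$, which is summable.
Almost sure convergence follows because the sum of the squared deviations has finite expectation,
whatever the joint law for different $n$. -/

namespace TensorCovariance

/-! ### Bipartite graphs of closed words -/

/-- The number of edges of the list `u ↦ (a u, i u)` that join `t` to `j`. -/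
def edgeCount {U S J : Type*} [Fintype U] [DecidableEq S] [DecidableEq J]
    (a : U → S) (i : U → J) (t : S) (j : J) : ℕ :=
  (Finset.univ.filter fun u => a u = t ∧ i u = j).card

/-- The glued edges of the bipartite multigraph with edges `(a u, i u)` and `(b u, i u)`. -/
def gluedEdges {U S J : Type*} [Fintype U] [DecidableEq S] [DecidableEq J]
    (a b : U → S) (i : U → J) : Finset (S × J) :=
  Finset.univ.image (fun u => (a u, i u)) ∪ Finset.univ.image (fun u => (b u, i u))

/-- The digraph with arrows `a u → b u` is (weakly) connected. -/
def Linked {U S : Type*} (a b : U → S) : Prop :=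
  ∀ f : S → Prop, (∀ u, f (a u) ↔ f (b u)) → ∀ s s', f s → f s'

/-- Every vertex of the digraph with arrows `a u → b u` has as many outgoing as incoming arrows. -/
def Balanced {U S : Type*} [Fintype U] [DecidableEq S] (a b : U → S) : Prop :=
  ∀ t, (Finset.univ.filter fun u => a u = t).card = (Finset.univ.filter fun u => b u = t).card

/-- The bipartite graph with a given set of edges. -/
def bipartiteGraph {S J : Type*} (E : Finset (S × J)) : SimpleGraph (S ⊕ J) :=
  SimpleGraph.fromRel fun v w => ∃ e ∈ E, v = Sum.inl e.1 ∧ w = Sum.inr e.2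

theorem bipartiteGraph_adj_inl_inr {S J : Type*} (E : Finset (S × J)) (t : S) (j : J) :
    (bipartiteGraph E).Adj (Sum.inl t) (Sum.inr j) ↔ (t, j) ∈ E := by
  simp [bipartiteGraph, SimpleGraph.fromRel_adj]

theorem bipartiteGraph_edgeSet {S J : Type*} (E : Finset (S × J)) :
    (bipartiteGraph E).edgeSet =
      (fun e : S × J => s((Sum.inl e.1 : S ⊕ J), Sum.inr e.2)) '' (E : Set (S × J)) := by
  ext e
  induction e with
  | _ v w =>
    rw [SimpleGraph.mem_edgeSet, bipartiteGraph, SimpleGraph.fromRel_adj]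
    constructor
    · rintro ⟨-, ⟨e, he, rfl, rfl⟩ | ⟨e, he, rfl, rfl⟩⟩
      · exact ⟨e, he, rfl⟩
      · exact ⟨e, he, Sym2.eq_swap⟩
    · rintro ⟨e, he, h⟩
      rcases Sym2.eq_iff.mp h with ⟨rfl, rfl⟩ | ⟨rfl, rfl⟩
      · exact ⟨by simp, Or.inl ⟨e, he, rfl, rfl⟩⟩
      · exact ⟨by simp, Or.inr ⟨e, he, rfl, rfl⟩⟩

theorem ncard_edgeSet_bipartiteGraph {S J : Type*} (E : Finset (S × J)) :
    (bipartiteGraph E).edgeSet.ncard = E.card := by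
  rw [bipartiteGraph_edgeSet, Set.ncard_image_of_injective, Set.ncard_coe_finset]
  rintro ⟨a, b⟩ ⟨c, d⟩ h
  simpa using h

section Words

variable {U S J : Type*} [Fintype U] [DecidableEq S] [DecidableEq J]

theorem mem_gluedEdges {a b : U → S} {i : U → J} {e : S × J} :
    e ∈ gluedEdges a b i ↔ 0 < edgeCount a i e.1 e.2 + edgeCount b i e.1 e.2 := by
  obtain ⟨t, j⟩ := e
  have h (c : U → S) : (t, j) ∈ Finset.univ.image (fun u => (c u, i u)) ↔
      0 < edgeCount c i t j := by
    simp [edgeCount, Finset.card_pos, Finset.Nonempty]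
  rw [gluedEdges, Finset.mem_union, h, h]
  simp only
  omega

theorem edgeCount_eq_zero {a b : U → S} {i : U → J} {t : S} {j : J}
    (h : (t, j) ∉ gluedEdges a b i) : edgeCount a i t j = 0 ∧ edgeCount b i t j = 0 := by
  rw [mem_gluedEdges] at h
  simp only at h
  omega

theorem left_mem_gluedEdges (a b : U → S) (i : U → J) (u : U) :
    (a u, i u) ∈ gluedEdges a b i :=
  Finset.mem_union_left _ (Finset.mem_image_of_mem _ (Finset.mem_univ u))

theorem right_mem_gluedEdges (a b : U → S) (i : U → J) (u : U) :
    (b u, i u) ∈ gluedEdges a b i :=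
  Finset.mem_union_right _ (Finset.mem_image_of_mem _ (Finset.mem_univ u))

theorem sum_gluedEdges_edgeCount (a b : U → S) (i : U → J) :
    ∑ e ∈ gluedEdges a b i, (edgeCount a i e.1 e.2 + edgeCount b i e.1 e.2) =
      2 * Fintype.card U := by
  have h (c : U → S) (hc : ∀ u, (c u, i u) ∈ gluedEdges a b i) :
      ∑ e ∈ gluedEdges a b i, edgeCount c i e.1 e.2 = Fintype.card U := by
    rw [← Finset.card_univ, Finset.card_eq_sum_card_fiberwise (f := fun u => (c u, i u))
      (t := gluedEdges a b i) (fun u _ => hc u)]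
    refine Finset.sum_congr rfl fun e _ => ?_
    simp [edgeCount, Prod.ext_iff]
  rw [Finset.sum_add_distrib, h a (left_mem_gluedEdges a b i),
    h b (right_mem_gluedEdges a b i), two_mul]

theorem edgeCount_comp_left {X : Type*} [DecidableEq X] {f : S → X} (hf : f.Injective)
    (a : U → S) (i : U → J) (t : S) (j : J) :
    edgeCount (f ∘ a) i (f t) j = edgeCount a i t j := by
  simp [edgeCount, hf.eq_iff]

theorem edgeCount_comp_right {X : Type*} [DecidableEq X] {f : J → X} (hf : f.Injective)
    (a : U → S) (i : U → J) (t : S) (j : J) :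
    edgeCount a (f ∘ i) t (f j) = edgeCount a i t j := by
  simp [edgeCount, hf.eq_iff]

theorem gluedEdges_comp_right {X : Type*} [DecidableEq X] (f : J → X)
    (a b : U → S) (i : U → J) :
    gluedEdges a b (f ∘ i) = (gluedEdges a b i).image (Prod.map id f) := by
  simp [gluedEdges, Finset.image_union, Finset.image_image, Function.comp_def]

theorem card_gluedEdges_comp_right {X : Type*} [DecidableEq X] {f : J → X} (hf : f.Injective)
    (a b : U → S) (i : U → J) :
    (gluedEdges a b (f ∘ i)).card = (gluedEdges a b i).card := by
  rw [gluedEdges_comp_right, Finset.card_image_of_injective _ (Function.injective_id.prodMap hf)]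

/-- Each letter joins its source and its target through its column, so reachability passes along
every arrow of the digraph. -/
theorem connected_bipartiteGraph [Nonempty S] {a b : U → S} {i : U → J}
    (hl : Linked a b) (hi : i.Surjective) :
    (bipartiteGraph (gluedEdges a b i)).Connected := by
  obtain ⟨s₀⟩ := ‹Nonempty S›
  set G := bipartiteGraph (gluedEdges a b i)
  have ha (u : U) : G.Adj (Sum.inl (a u)) (Sum.inr (i u)) :=
    (bipartiteGraph_adj_inl_inr _ _ _).2 (left_mem_gluedEdges a b i u)
  have hb (u : U) : G.Adj (Sum.inl (b u)) (Sum.inr (i u)) :=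
    (bipartiteGraph_adj_inl_inr _ _ _).2 (right_mem_gluedEdges a b i u)
  have hS (s : S) : G.Reachable (Sum.inl s₀) (Sum.inl s) := by
    refine hl (fun s => G.Reachable (Sum.inl s₀) (Sum.inl s)) (fun u => ?_) s₀ s
      (SimpleGraph.Reachable.refl _)
    have h := (ha u).reachable.trans (hb u).symm.reachable
    exact ⟨fun h' => h'.trans h, fun h' => h'.trans h.symm⟩
  have hall (v : S ⊕ J) : G.Reachable (Sum.inl s₀) v := by
    rcases v with s | j
    · exact hS s
    · obtain ⟨u, rfl⟩ := hi j
      exact (hS (a u)).trans (ha u).reachable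
  exact { preconnected := fun v w => (hall v).symm.trans (hall w), nonempty := ⟨Sum.inl s₀⟩ }

variable [Fintype S] [Fintype J]

theorem card_add_card_le_of_surjective [Nonempty S] {a b : U → S} {i : U → J}
    (hl : Linked a b) (hi : i.Surjective) :
    Fintype.card S + Fintype.card J ≤ (gluedEdges a b i).card + 1 := by
  have h := (connected_bipartiteGraph hl hi).card_vert_le_card_edgeSet_add_one
  rwa [Nat.card_eq_fintype_card, Fintype.card_sum, Nat.card_coe_set_eq,
    ncard_edgeSet_bipartiteGraph] at h

theorem isTree_bipartiteGraph [Nonempty S] {a b : U → S} {i : U → J}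
    (hl : Linked a b) (hi : i.Surjective)
    (hE : Fintype.card S + Fintype.card J = (gluedEdges a b i).card + 1) :
    (bipartiteGraph (gluedEdges a b i)).IsTree := by
  rw [SimpleGraph.isTree_iff_connected_and_card]
  refine ⟨connected_bipartiteGraph hl hi, ?_⟩
  rw [Nat.card_coe_set_eq, ncard_edgeSet_bipartiteGraph, Nat.card_eq_fintype_card,
    Fintype.card_sum, hE]

/-- A closed word traverses every edge of a tree equally often in both directions. -/
theorem edgeCount_eq_of_isTree {a b : U → S} {i : U → J} (hbal : Balanced a b)
    (hT : (bipartiteGraph (gluedEdges a b i)).IsTree) (t : S) (j : J) :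
    edgeCount a i t j = edgeCount b i t j := by
  classical
  by_cases htj : (t, j) ∈ gluedEdges a b i
  swap
  · have := edgeCount_eq_zero htj
    omega
  set G := bipartiteGraph (gluedEdges a b i)
  have hadj : G.Adj (Sum.inl t) (Sum.inr j) := (bipartiteGraph_adj_inl_inr _ _ _).2 htj
  have hbr := SimpleGraph.isAcyclic_iff_forall_adj_isBridge.1 hT.isAcyclic hadj
  rw [SimpleGraph.isBridge_iff] at hbr
  -- The edge is a bridge. Let `f` be the indicator of the component of `t` once it is deleted: `f`
  -- differs at the two ends of an edge only for the deleted one. Hence the sum of these differences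
  -- counts the uses of the bridge, and balancedness makes the count the same for sources and
  -- targets.
  set H := G.deleteEdges {s((Sum.inl t : S ⊕ J), Sum.inr j)}
  let f : S ⊕ J → ℤ := fun v => if H.Reachable (Sum.inl t) v then 1 else 0
  have hft : f (Sum.inl t) = 1 := if_pos (SimpleGraph.Reachable.refl _)
  have hfj : f (Sum.inr j) = 0 := if_neg hbr
  have hf (c : U → S) (hc : ∀ u, (c u, i u) ∈ gluedEdges a b i) (u : U) :
      f (Sum.inl (c u)) - f (Sum.inr (i u)) = if c u = t ∧ i u = j then 1 else 0 := by
    split_ifs with h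
    · rw [h.1, h.2, hft, hfj, sub_zero]
    · have hH : H.Adj (Sum.inl (c u)) (Sum.inr (i u)) := by
        rw [SimpleGraph.deleteEdges_adj]
        refine ⟨(bipartiteGraph_adj_inl_inr _ _ _).2 (hc u), ?_⟩
        simpa using h
      have : H.Reachable (Sum.inl t) (Sum.inl (c u)) ↔
          H.Reachable (Sum.inl t) (Sum.inr (i u)) :=
        ⟨fun h' => h'.trans hH.reachable, fun h' => h'.trans hH.symm.reachable⟩
      simp only [f, this, sub_self]
  have hsum (c : U → S) (hc : ∀ u, (c u, i u) ∈ gluedEdges a b i) :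
      ∑ u, f (Sum.inl (c u)) - ∑ u, f (Sum.inr (i u)) = edgeCount c i t j := by
    rw [← Finset.sum_sub_distrib, Finset.sum_congr rfl fun u _ => hf c hc u, edgeCount]
    simp
  have hab : ∑ u, f (Sum.inl (a u)) = ∑ u, f (Sum.inl (b u)) := by
    have h (c : U → S) : ∑ u, f (Sum.inl (c u)) =
        ∑ s, (Finset.univ.filter fun u => c u = s).card • f (Sum.inl s) := by
      rw [← Finset.sum_fiberwise (s := Finset.univ) (g := c)]
      refine Finset.sum_congr rfl fun s _ => ?_
      rw [← Finset.sum_const]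
      refine Finset.sum_congr rfl fun u hu => ?_
      rw [(Finset.mem_filter.1 hu).2]
    rw [h a, h b]
    exact Finset.sum_congr rfl fun s _ => by rw [hbal s]
  have h1 := hsum a (left_mem_gluedEdges a b i)
  have h2 := hsum b (right_mem_gluedEdges a b i)
  rw [hab] at h1
  exact_mod_cast h1.symm.trans h2

end Words

/-! ### Weights of bipartite words -/

/-- The weight of a bipartite multigraph when an edge `(t, j)` of multiplicities `(x, y)` in the
two directions has weight `κ x y`. -/
noncomputable def wordWeight {U S J : Type*} [Fintype U] [DecidableEq S] [DecidableEq J]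
    [Fintype S] [Fintype J] (κ : ℕ → ℕ → ℂ) (a b : U → S) (i : U → J) : ℂ :=
  ∏ e : S × J, κ (edgeCount a i e.1 e.2) (edgeCount b i e.1 e.2)

/-- The sum of the weights over all `i : U → Fin n`. -/
noncomputable def wordSum {U S : Type*} [Fintype U] [DecidableEq U] [DecidableEq S]
    [Fintype S] (κ : ℕ → ℕ → ℂ) (a b : U → S) (n : ℕ) : ℂ :=
  ∑ i : U → Fin n, wordWeight κ a b i

/-- The properties of the mixed moments of a centered random variable of unit variance that
matter for the leading order. -/
structure IsStandardMoments (κ : ℕ → ℕ → ℂ) : Prop where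
  zero_zero : κ 0 0 = 1
  one_zero : κ 1 0 = 0
  zero_one : κ 0 1 = 0
  one_one : κ 1 1 = 1

/-- `K` bounds the mixed moments up to order `N` in each variable. -/
def MomentBound (κ : ℕ → ℕ → ℂ) (N : ℕ) (K : ℝ) : Prop :=
  1 ≤ K ∧ ∀ x ≤ N, ∀ y ≤ N, ‖κ x y‖ ≤ K ^ (x + y)

theorem IsStandardMoments.exists_momentBound {κ : ℕ → ℕ → ℂ} (hκ : IsStandardMoments κ) (N : ℕ) :
    ∃ K, MomentBound κ N K := by
  set T : ℝ := ∑ x ∈ Finset.range (N + 1), ∑ y ∈ Finset.range (N + 1), ‖κ x y‖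
  have hT : 0 ≤ T := by positivity
  refine ⟨1 + T, by linarith, fun x hx y hy => ?_⟩
  rcases Nat.eq_zero_or_pos (x + y) with h | h
  · obtain ⟨rfl, rfl⟩ : x = 0 ∧ y = 0 := by omega
    simp [hκ.zero_zero]
  · have h1 : ‖κ x y‖ ≤ T := by
      refine le_trans ?_ (Finset.single_le_sum (f := fun x => ∑ y ∈ Finset.range (N + 1), ‖κ x y‖)
        (fun _ _ => by positivity) (Finset.mem_range.2 (Nat.lt_succ_of_le hx)))
      exact Finset.single_le_sum (f := fun y => ‖κ x y‖)
        (fun _ _ => by positivity) (Finset.mem_range.2 (Nat.lt_succ_of_le hy))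
    calc ‖κ x y‖ ≤ 1 + T := by linarith
      _ ≤ (1 + T) ^ (x + y) := le_self_pow₀ (by linarith) (by omega)

theorem exists_eq_comp_of_card_image_le {U J : Type*} [Fintype U] [DecidableEq J]
    (i : U → J) (r : ℕ) (h : (Finset.univ.image i).card ≤ r) (hJ : Nonempty J ∨ r = 0) :
    ∃ (φ : Fin r → J) (γ : U → Fin r), i = φ ∘ γ := by
  classical
  rcases isEmpty_or_nonempty U with hU | hU
  · rcases hJ with hJ | rfl
    · exact ⟨fun _ => hJ.some, hU.elim, funext hU.elim⟩
    · exact ⟨fun x => x.elim0, hU.elim, funext hU.elim⟩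
  · let e := (Finset.univ.image i).equivFin
    let γ : U → Fin r := fun u =>
      Fin.castLE h (e ⟨i u, Finset.mem_image_of_mem _ (Finset.mem_univ u)⟩)
    -- Indices beyond the size of the image are never hit by `γ`; they receive an arbitrary value.
    refine ⟨fun x => if hx : (x : ℕ) < (Finset.univ.image i).card then (e.symm ⟨x, hx⟩ : J)
      else i hU.some, γ, ?_⟩
    funext u
    simp [γ]

theorem card_filter_card_image_le {U : Type*} [Fintype U] [DecidableEq U] (n r : ℕ)
    (hn : 1 ≤ n) :
    (Finset.univ.filter fun i : U → Fin n => (Finset.univ.image i).card ≤ r).card ≤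
      r ^ Fintype.card U * n ^ r := by
  classical
  have hsub : (Finset.univ.filter fun i : U → Fin n => (Finset.univ.image i).card ≤ r) ⊆
      Finset.univ.image (fun q : (U → Fin r) × (Fin r → Fin n) => q.2 ∘ q.1) := by
    intro i hi
    obtain ⟨φ, γ, rfl⟩ := exists_eq_comp_of_card_image_le i r (Finset.mem_filter.1 hi).2
      (Or.inl ⟨⟨0, hn⟩⟩)
    exact Finset.mem_image.2 ⟨(γ, φ), Finset.mem_univ _, rfl⟩
  refine (Finset.card_le_card hsub).trans (Finset.card_image_le.trans ?_)
  simp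

section Words

variable {U S J : Type*} [Fintype U] [DecidableEq S] [DecidableEq J]

theorem edgeCount_le_card (a : U → S) (i : U → J) (t : S) (j : J) :
    edgeCount a i t j ≤ Fintype.card U :=
  Finset.card_filter_le _ _

theorem sum_edgeCount_right [Fintype J] (a : U → S) (i : U → J) (t : S) :
    ∑ j, edgeCount a i t j = (Finset.univ.filter fun u => a u = t).card := by
  rw [Finset.card_eq_sum_card_fiberwise (f := i) (t := Finset.univ) (fun _ _ => Finset.mem_univ _)]
  simp [edgeCount, Finset.filter_filter]

/-- The list of columns of a word, with its range as codomain. -/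
def rangeWord (i : U → J) : U → {j // j ∈ Finset.univ.image i} :=
  fun u => ⟨i u, Finset.mem_image_of_mem _ (Finset.mem_univ u)⟩

theorem rangeWord_surjective (i : U → J) : (rangeWord i).Surjective := by
  rintro ⟨j, hj⟩
  obtain ⟨u, -, rfl⟩ := Finset.mem_image.1 hj
  exact ⟨u, rfl⟩

theorem card_gluedEdges_rangeWord (a b : U → S) (i : U → J) :
    (gluedEdges a b (rangeWord i)).card = (gluedEdges a b i).card :=
  (card_gluedEdges_comp_right Subtype.val_injective a b (rangeWord i)).symm

theorem card_gluedEdges_le {a b : U → S} {i : U → J}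
    (h : ∀ t j, (t, j) ∈ gluedEdges a b i → 2 ≤ edgeCount a i t j + edgeCount b i t j) :
    (gluedEdges a b i).card ≤ Fintype.card U := by
  have h1 := sum_gluedEdges_edgeCount a b i
  have h2 := Finset.card_nsmul_le_sum (gluedEdges a b i)
    (fun e => edgeCount a i e.1 e.2 + edgeCount b i e.1 e.2) 2 (fun e he => h e.1 e.2 he)
  simp only [smul_eq_mul] at h2
  omega

variable [Fintype S]

theorem card_add_card_image_le [Nonempty S] {a b : U → S} (hl : Linked a b) (i : U → J) :
    Fintype.card S + (Finset.univ.image i).card ≤ (gluedEdges a b i).card + 1 := by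
  have h := card_add_card_le_of_surjective hl (rangeWord_surjective i)
  rwa [card_gluedEdges_rangeWord, Fintype.card_coe] at h

/-- A connected graph with one vertex more than edges is a tree; columns outside the range of `i`
carry no edge. -/
theorem edgeCount_eq_of_card_eq [Nonempty S] {a b : U → S} (hl : Linked a b)
    (hbal : Balanced a b) (i : U → J)
    (hE : (gluedEdges a b i).card + 1 ≤ Fintype.card S + (Finset.univ.image i).card)
    (t : S) (j : J) : edgeCount a i t j = edgeCount b i t j := by
  by_cases hj : j ∈ Finset.univ.image i
  · have hT := isTree_bipartiteGraph hl (rangeWord_surjective i) (by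
      rw [card_gluedEdges_rangeWord, Fintype.card_coe]
      exact le_antisymm (card_add_card_image_le hl i) hE)
    have h := edgeCount_eq_of_isTree hbal hT t ⟨j, hj⟩
    have h' (c : U → S) := edgeCount_comp_right Subtype.val_injective c (rangeWord i) t ⟨j, hj⟩
    rw [← h', ← h'] at h
    exact h
  · have h (c : U → S) : edgeCount c i t j = 0 := by
      rw [edgeCount, Finset.card_eq_zero, Finset.filter_eq_empty_iff]
      rintro u - ⟨-, rfl⟩
      exact hj (Finset.mem_image_of_mem _ (Finset.mem_univ u))
    rw [h, h]

variable [Fintype J] {κ : ℕ → ℕ → ℂ}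

theorem wordWeight_eq_prod_gluedEdges (hκ : IsStandardMoments κ) (a b : U → S) (i : U → J) :
    wordWeight κ a b i =
      ∏ e ∈ gluedEdges a b i, κ (edgeCount a i e.1 e.2) (edgeCount b i e.1 e.2) := by
  refine (Finset.prod_subset (Finset.subset_univ _) fun e _ he => ?_).symm
  obtain ⟨h1, h2⟩ := edgeCount_eq_zero (t := e.1) (j := e.2) he
  rw [h1, h2, hκ.zero_zero]

theorem wordWeight_comp_right {X : Type*} [Fintype X] [DecidableEq X]
    (hκ : IsStandardMoments κ) {f : J → X} (hf : f.Injective) (a b : U → S) (i : U → J) :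
    wordWeight κ a b (f ∘ i) = wordWeight κ a b i := by
  rw [wordWeight_eq_prod_gluedEdges hκ, wordWeight_eq_prod_gluedEdges hκ, gluedEdges_comp_right,
    Finset.prod_image (Function.injective_id.prodMap hf).injOn]
  refine Finset.prod_congr rfl fun e _ => ?_
  simp [edgeCount_comp_right hf]

theorem wordWeight_comp_left {X : Type*} [Fintype X] [DecidableEq X]
    (hκ : IsStandardMoments κ) {f : S → X} (hf : f.Injective) (a b : U → S) (i : U → J) :
    wordWeight κ (f ∘ a) (f ∘ b) i = wordWeight κ a b i := by
  have h : gluedEdges (f ∘ a) (f ∘ b) i = (gluedEdges a b i).image (Prod.map f id) := by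
    simp [gluedEdges, Finset.image_union, Finset.image_image, Function.comp_def]
  rw [wordWeight_eq_prod_gluedEdges hκ, wordWeight_eq_prod_gluedEdges hκ, h,
    Finset.prod_image (hf.prodMap Function.injective_id).injOn]
  refine Finset.prod_congr rfl fun e _ => ?_
  simp [edgeCount_comp_left hf]

/-- The bound `K ^ (x + y)` multiplies well: the multiplicities of all glued edges add up to twice
the number of letters. -/
theorem norm_wordWeight_le {K : ℝ} {N : ℕ} (hK : MomentBound κ N K) (hκ : IsStandardMoments κ)
    (hN : Fintype.card U ≤ N) (a b : U → S) (i : U → J) :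
    ‖wordWeight κ a b i‖ ≤ K ^ (2 * Fintype.card U) := by
  rw [wordWeight_eq_prod_gluedEdges hκ, norm_prod, ← sum_gluedEdges_edgeCount a b i,
    ← Finset.prod_pow_eq_pow_sum]
  exact Finset.prod_le_prod (fun _ _ => norm_nonneg _) fun e _ =>
    hK.2 _ ((edgeCount_le_card _ _ _ _).trans hN) _ ((edgeCount_le_card _ _ _ _).trans hN)

theorem two_le_of_wordWeight_ne_zero (hκ : IsStandardMoments κ) {a b : U → S} {i : U → J}
    (h : wordWeight κ a b i ≠ 0) {t : S} {j : J} (htj : (t, j) ∈ gluedEdges a b i) :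
    2 ≤ edgeCount a i t j + edgeCount b i t j := by
  have h0 := (Finset.prod_ne_zero_iff.1 h) (t, j) (Finset.mem_univ _)
  have h1 := mem_gluedEdges.1 htj
  simp only at h0 h1
  by_contra hlt
  obtain ⟨h2, h3⟩ | ⟨h2, h3⟩ : (edgeCount a i t j = 1 ∧ edgeCount b i t j = 0) ∨
      (edgeCount a i t j = 0 ∧ edgeCount b i t j = 1) := by omega
  · exact h0 (by rw [h2, h3, hκ.one_zero])
  · exact h0 (by rw [h2, h3, hκ.zero_one])

/-- Centering kills simple edges, so there are at most as many glued edges as letters, and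
connectedness bounds the vertices. -/
theorem card_image_le_of_wordWeight_ne_zero [Nonempty S] (hκ : IsStandardMoments κ)
    {a b : U → S} (hl : Linked a b) {i : U → J} (h : wordWeight κ a b i ≠ 0) :
    Fintype.card S + (Finset.univ.image i).card ≤ Fintype.card U + 1 := by
  have h1 := card_add_card_image_le hl i
  have h2 := card_gluedEdges_le (fun t j => two_le_of_wordWeight_ne_zero hκ h (t := t) (j := j))
  omega

end Words

/-! ### Crude bounds on word sums -/

section Bound

variable {U S : Type*} [Fintype U] [DecidableEq U] [DecidableEq S] [Fintype S] {κ : ℕ → ℕ → ℂ}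

theorem wordSum_comp_left {X : Type*} [Fintype X] [DecidableEq X]
    (hκ : IsStandardMoments κ) {f : S → X} (hf : f.Injective) (a b : U → S) (n : ℕ) :
    wordSum κ (f ∘ a) (f ∘ b) n = wordSum κ a b n :=
  Finset.sum_congr rfl fun i _ => wordWeight_comp_left hκ hf a b i

/-- A sum over words supported on words with at most `r` columns. -/
theorem norm_sum_le_of_card_image {n r : ℕ} (hn : 1 ≤ n) {C : ℝ} (hC : 0 ≤ C)
    (h : (U → Fin n) → ℂ) (hbound : ∀ i, ‖h i‖ ≤ C)
    (hsupp : ∀ i, h i ≠ 0 → (Finset.univ.image i).card ≤ r) :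
    ‖∑ i, h i‖ ≤ C * (r ^ Fintype.card U * n ^ r) := by
  classical
  have h1 : ∑ i, h i =
      ∑ i ∈ Finset.univ.filter fun i : U → Fin n => (Finset.univ.image i).card ≤ r, h i := by
    refine (Finset.sum_subset (Finset.subset_univ _) fun i _ hi => ?_).symm
    by_contra hne
    exact hi (Finset.mem_filter.2 ⟨Finset.mem_univ _, hsupp i hne⟩)
  rw [h1]
  refine (norm_sum_le_of_le _ fun i _ => hbound i).trans ?_
  rw [Finset.sum_const, nsmul_eq_mul, mul_comm]
  refine mul_le_mul_of_nonneg_left ?_ hC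
  exact_mod_cast card_filter_card_image_le (U := U) n r hn

theorem norm_wordSum_le [Nonempty S] {K : ℝ} {N : ℕ} (hK : MomentBound κ N K)
    (hκ : IsStandardMoments κ) (hN : Fintype.card U ≤ N) {a b : U → S} (hl : Linked a b)
    {n : ℕ} (hn : 1 ≤ n) :
    ‖wordSum κ a b n‖ ≤ K ^ (2 * N) * (N + 1) ^ N *
      n ^ (Fintype.card U + 1 - Fintype.card S) := by
  have hK0 : 0 ≤ K := zero_le_one.trans hK.1
  refine (norm_sum_le_of_card_image hn (pow_nonneg hK0 _) _
    (fun i => norm_wordWeight_le hK hκ hN a b i)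
    (r := Fintype.card U + 1 - Fintype.card S) fun i hi => ?_).trans ?_
  · have := card_image_le_of_wordWeight_ne_zero hκ hl hi
    omega
  · rw [mul_assoc]
    refine mul_le_mul (pow_le_pow_right₀ hK.1 (by omega)) ?_ (by positivity) (by positivity)
    refine mul_le_mul_of_nonneg_right ?_ (by positivity)
    calc ((Fintype.card U + 1 - Fintype.card S : ℕ) : ℝ) ^ Fintype.card U
        ≤ ((N : ℝ) + 1) ^ Fintype.card U := by
          refine pow_le_pow_left₀ (by positivity) ?_ _
          have : Fintype.card U + 1 - Fintype.card S ≤ N + 1 := by omega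
          exact_mod_cast this
      _ ≤ ((N : ℝ) + 1) ^ N := pow_le_pow_right₀ (by linarith [Nat.cast_nonneg (α := ℝ) N]) hN

end Bound

/-! ### Asymptotics of tree words -/

section Split

variable {U S J : Type*} [Fintype U] [DecidableEq S] [DecidableEq J]

theorem edgeCount_split [DecidableEq U] (u : U) (a : U → S) (i : U → J) (t : S) (j : J) :
    edgeCount a i t j =
      edgeCount (fun x : {x // x ≠ u} => a x) (fun x : {x // x ≠ u} => i x) t j +
        if a u = t ∧ i u = j then 1 else 0 := by
  simp only [edgeCount, Finset.card_filter]
  rw [← Finset.add_sum_erase _ _ (Finset.mem_univ u), add_comm]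
  congr 1
  exact (Finset.sum_subtype _ (by simp) _)

theorem edgeCount_comp_perm (σ : Equiv.Perm U) (a : U → S) (i : U → J) (t : S) (j : J) :
    edgeCount (a ∘ σ) (i ∘ σ) t j = edgeCount a i t j :=
  Finset.card_equiv σ (by simp)

theorem card_filter_eq_edgeCount (a : U → S) (t : S) :
    (Finset.univ.filter fun u => a u = t).card = edgeCount a (fun _ => ()) t () := by
  simp [edgeCount]

end Split

/-- A word `(a, b)` with columns `i` whose glued graph is a tree with doubled edges. -/
structure IsTreeWord {U S J : Type*} [Fintype U] [DecidableEq S] [DecidableEq J] [Fintype S]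
    [Fintype J] (a b : U → S) (i : U → J) : Prop where
  nonempty : Nonempty S
  linked : Linked a b
  balanced : Balanced a b
  surjective : i.Surjective
  mult : ∀ t j, edgeCount a i t j + edgeCount b i t j ≠ 1
  card : Fintype.card S + Fintype.card J = Fintype.card U + 1

/-! ### Words with the maximal number of columns -/

section EdgeCount

variable {U S J : Type*} [Fintype U] [DecidableEq S] [DecidableEq J] [Fintype S]

/-- One exceptional edge is tolerated because a loop, when added, can thicken one simple edge. By
counting, `2 * E.card ≤ 2 * Fintype.card U + 1`, and parity removes the extra 1; so the graph is a
tree. Then both directions agree on each edge, every multiplicity is at least 2, and the total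
leaves no room for more. -/
theorem edgeCount_eq_one_of_card_le [Nonempty S] {a b : U → S} (hl : Linked a b)
    (hbal : Balanced a b) (i : U → J)
    (hcard : Fintype.card U + 1 ≤ Fintype.card S + (Finset.univ.image i).card) (e₀ : S × J)
    (h : ∀ e ∈ gluedEdges a b i, e ≠ e₀ → 2 ≤ edgeCount a i e.1 e.2 + edgeCount b i e.1 e.2) :
    ∀ e ∈ gluedEdges a b i, edgeCount a i e.1 e.2 = 1 ∧ edgeCount b i e.1 e.2 = 1 := by
  set E := gluedEdges a b i
  have hsum : ∑ e ∈ E, (edgeCount a i e.1 e.2 + edgeCount b i e.1 e.2) = 2 * Fintype.card U :=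
    sum_gluedEdges_edgeCount a b i
  have h1 := card_add_card_image_le hl i
  have h2 : E.card * 2 ≤ 2 * Fintype.card U + 1 := by
    calc E.card * 2 = ∑ e ∈ E, 2 := by simp
      _ ≤ ∑ e ∈ E, (edgeCount a i e.1 e.2 + edgeCount b i e.1 e.2 + if e = e₀ then 1 else 0) := by
          refine Finset.sum_le_sum fun e he => ?_
          split_ifs with hee
          · have := mem_gluedEdges.1 he
            omega
          · exact (h e he hee).trans (by omega)
      _ ≤ 2 * Fintype.card U + 1 := by
          rw [Finset.sum_add_distrib, hsum, Finset.sum_ite_eq']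
          split_ifs <;> omega
  have heq := edgeCount_eq_of_card_eq hl hbal i
    (show (gluedEdges a b i).card + 1 ≤ _ by change E.card + 1 ≤ _; omega)
  have hge (e) (he : e ∈ E) : 2 ≤ edgeCount a i e.1 e.2 + edgeCount b i e.1 e.2 := by
    have := mem_gluedEdges.1 he
    have := heq e.1 e.2
    omega
  have hall := (Finset.sum_eq_sum_iff_of_le (f := fun _ => 2) hge).1 (by
    rw [hsum]
    simp
    change Fintype.card U + 1 ≤ Fintype.card S + (Finset.univ.image i).card at hcard
    change Fintype.card S + (Finset.univ.image i).card ≤ E.card + 1 at h1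
    omega)
  intro e he
  have := hall e he
  have := heq e.1 e.2
  omega

theorem IsTreeWord.edgeCount_eq_one [Fintype J] {a b : U → S} {i : U → J}
    (h : IsTreeWord a b i) {t : S} {j : J} (htj : (t, j) ∈ gluedEdges a b i) :
    edgeCount a i t j = 1 ∧ edgeCount b i t j = 1 := by
  have := h.nonempty
  refine edgeCount_eq_one_of_card_le h.linked h.balanced i ?_ (t, j) (fun e he _ => ?_) _ htj
  · rw [Finset.image_univ_of_surjective h.surjective, Finset.card_univ, h.card]
  · have := h.mult e.1 e.2
    have := mem_gluedEdges.1 he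
    omega

end EdgeCount

/-! ### Adding a loop to a word -/

section Loop

variable {U S : Type*} [Fintype U] [DecidableEq U] [DecidableEq S] [Fintype S] {κ : ℕ → ℕ → ℂ}

theorem wordWeight_loop_of_notMem {J : Type*} [Fintype J] [DecidableEq J]
    (hκ : IsStandardMoments κ) {a b : U → S} {u : U} (hu : a u = b u) (i : U → J)
    (h : (a u, i u) ∉ gluedEdges (fun x : {x // x ≠ u} => a x) (fun x => b x) (fun x => i x)) :
    wordWeight κ a b i =
      wordWeight κ (fun x : {x // x ≠ u} => a x) (fun x => b x) (fun x => i x) := by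
  refine Finset.prod_congr rfl fun e _ => ?_
  rw [edgeCount_split u a, edgeCount_split u b, ← hu]
  split_ifs with he
  · obtain ⟨t, j⟩ := e
    obtain ⟨rfl, rfl⟩ := he
    obtain ⟨h1, h2⟩ := edgeCount_eq_zero h
    rw [h1, h2, hκ.zero_zero]
    exact hκ.one_one
  · rfl

/-- The bound `hcard` says that `i` has at least the maximal number of columns for the word without
`u`. If at most one edge is simple there, all edges have multiplicities (1, 1). The reduced weight
is then 1, a loop at a column adjacent to `a u` gives weight `κ 2 2`, and such columns are as many
as the remaining arrows leaving `a u`. -/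
theorem wordWeight_loop_dichotomy [Nonempty S] (hκ : IsStandardMoments κ) {a b : U → S} {u : U}
    (hu : a u = b u) (hl : Linked (fun x : {x // x ≠ u} => a x) (fun x => b x))
    (hbal : Balanced (fun x : {x // x ≠ u} => a x) (fun x => b x)) {n : ℕ} (hn : 1 ≤ n)
    (i : {x // x ≠ u} → Fin n)
    (hcard : Fintype.card U ≤ Fintype.card S + (Finset.univ.image i).card) :
    ∑ j ∈ Finset.univ.filter (fun j =>
        (a u, j) ∈ gluedEdges (fun x : {x // x ≠ u} => a x) (fun x => b x) i),
        (wordWeight κ a b ((Equiv.funSplitAt u (Fin n)).symm (j, i)) -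
          wordWeight κ (fun x : {x // x ≠ u} => a x) (fun x => b x) i) =
      (Finset.univ.filter fun x : {x // x ≠ u} => a x = a u).card * (κ 2 2 - 1) *
        wordWeight κ (fun x : {x // x ≠ u} => a x) (fun x => b x) i := by
  set a' : {x // x ≠ u} → S := fun x => a x
  set b' : {x // x ≠ u} → S := fun x => b x
  set E := gluedEdges a' b' i
  let ext (j : Fin n) : U → Fin n := (Equiv.funSplitAt u (Fin n)).symm (j, i)
  have hextu (j) : ext j u = j := by simp [ext, Equiv.funSplitAt]
  have hext (j) : (fun x : {x // x ≠ u} => ext j x) = i := by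
    funext x
    simp [ext, Equiv.funSplitAt, x.2]
  have hca (j t j') : edgeCount a (ext j) t j' =
      edgeCount a' i t j' + if a u = t ∧ j = j' then 1 else 0 := by
    rw [edgeCount_split u, hext, hextu]
  have hcb (j t j') : edgeCount b (ext j) t j' =
      edgeCount b' i t j' + if a u = t ∧ j = j' then 1 else 0 := by
    rw [edgeCount_split u, hext, hextu, hu]
  have hU : Fintype.card {x // x ≠ u} + 1 = Fintype.card U := by
    have := Fintype.card_pos_iff.2 ⟨u⟩
    rw [Fintype.card_subtype_compl, Fintype.card_subtype_eq]
    omega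
  by_cases hall : ∃ e₀, ∀ e ∈ E, e ≠ e₀ → 2 ≤ edgeCount a' i e.1 e.2 + edgeCount b' i e.1 e.2
  · obtain ⟨e₀, he₀⟩ := hall
    have hone := edgeCount_eq_one_of_card_le hl hbal i (by omega) e₀ he₀
    have hw' : wordWeight κ a' b' i = 1 := by
      rw [wordWeight_eq_prod_gluedEdges hκ]
      refine Finset.prod_eq_one fun e he => ?_
      rw [(hone e he).1, (hone e he).2, hκ.one_one]
    have hcardN : ((Finset.univ.filter fun x : {x // x ≠ u} => a x = a u).card : ℕ) =
        (Finset.univ.filter fun j => (a u, j) ∈ E).card := by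
      rw [← sum_edgeCount_right a' i (a u), Finset.card_filter]
      refine Finset.sum_congr rfl fun j _ => ?_
      split_ifs with hj
      · exact (hone _ hj).1
      · exact (edgeCount_eq_zero hj).1
    rw [hw', hcardN, mul_one, ← nsmul_eq_mul, ← Finset.sum_const]
    refine Finset.sum_congr rfl fun j hj => ?_
    have hj := (Finset.mem_filter.1 hj).2
    congr 1
    have hj1 := hone _ hj
    simp only at hj1
    rw [wordWeight, Finset.prod_eq_single (a u, j)]
    · change κ (edgeCount a (ext j) (a u) j) (edgeCount b (ext j) (a u) j) = _
      rw [hca, hcb, hj1.1, hj1.2]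
      simp
    · rintro ⟨t, j'⟩ - hne
      change κ (edgeCount a (ext j) t j') (edgeCount b (ext j) t j') = 1
      have hne' : ¬ (a u = t ∧ j = j') := fun h => hne (by rw [h.1, h.2])
      rw [hca, hcb, if_neg hne']
      by_cases he : (t, j') ∈ E
      · have := hone _ he
        simp only at this
        rw [this.1, this.2]
        exact hκ.one_one
      · rw [(edgeCount_eq_zero he).1, (edgeCount_eq_zero he).2]
        exact hκ.zero_zero
    · exact fun h => absurd (Finset.mem_univ _) h
  -- Now at least two edges are simple. The loop can thicken only the edge `(a u, j)`, so all
  -- weights on both sides vanish.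
  · have hw' : wordWeight κ a' b' i = 0 := by
      by_contra hne
      exact hall ⟨(a u, ⟨0, hn⟩), fun e he _ => two_le_of_wordWeight_ne_zero hκ hne he⟩
    rw [hw', mul_zero]
    refine Finset.sum_eq_zero fun j hj => ?_
    rw [sub_zero]
    by_contra hne
    refine hall ⟨(a u, j), fun e he hej => ?_⟩
    have hne' : ¬ (a u = e.1 ∧ j = e.2) := fun h => hej (by rw [h.1, h.2])
    have h1 := hca j e.1 e.2
    have h2 := hcb j e.1 e.2
    rw [if_neg hne', add_zero] at h1 h2
    have hmem := mem_gluedEdges.1 he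
    rw [← h1, ← h2] at hmem ⊢
    exact two_le_of_wordWeight_ne_zero hκ hne (mem_gluedEdges.2 hmem)

/-- Effect on `wordSum` of adding a loop. -/
theorem wordSum_loop [Nonempty S] (hκ : IsStandardMoments κ) {a b : U → S} {u : U}
    (hu : a u = b u) (hl : Linked (fun x : {x // x ≠ u} => a x) (fun x => b x))
    (hbal : Balanced (fun x : {x // x ≠ u} => a x) (fun x => b x)) {r : ℕ}
    (hr : Fintype.card S + r = Fintype.card U) :
    ∃ C : ℝ, ∀ n : ℕ, 1 ≤ n →
      ‖wordSum κ a b n - (n + (Finset.univ.filter fun x : {x // x ≠ u} => a x = a u).card *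
          (κ 2 2 - 1)) * wordSum κ (fun x : {x // x ≠ u} => a x) (fun x => b x) n‖ * n ≤
        C * n ^ r := by
  obtain ⟨K, hK⟩ := hκ.exists_momentBound (Fintype.card U)
  have hK0 : 0 ≤ K := zero_le_one.trans hK.1
  set a' : {x // x ≠ u} → S := fun x => a x
  set b' : {x // x ≠ u} → S := fun x => b x
  set D : ℂ := (Finset.univ.filter fun x : {x // x ≠ u} => a x = a u).card * (κ 2 2 - 1)
  have hU : Fintype.card {x // x ≠ u} + 1 = Fintype.card U := by
    have := Fintype.card_pos_iff.2 ⟨u⟩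
    rw [Fintype.card_subtype_compl, Fintype.card_subtype_eq]
    omega
  set L : ℝ := K ^ (2 * Fintype.card U)
  have hL : 0 ≤ L := pow_nonneg hK0 _
  have hw' {n : ℕ} (i : {x // x ≠ u} → Fin n) : ‖wordWeight κ a' b' i‖ ≤ L :=
    (norm_wordWeight_le hK hκ (by omega) a' b' i).trans (pow_le_pow_right₀ hK.1 (by omega))
  -- At most `Fintype.card U` adjacent columns, each contributing a difference of two weights
  -- bounded by `L`, plus the predicted correction.
  set C₁ : ℝ := Fintype.card U * (L + L) + ‖D‖ * L
  refine ⟨C₁ * ((r - 1 : ℕ) ^ Fintype.card {x // x ≠ u}), fun n hn => ?_⟩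
  let ext (i : {x // x ≠ u} → Fin n) (j : Fin n) : U → Fin n :=
    (Equiv.funSplitAt u (Fin n)).symm (j, i)
  have hextu (i j) : ext i j u = j := by simp [ext, Equiv.funSplitAt]
  have hext (i j) : (fun x : {x // x ≠ u} => ext i j x) = i := by
    funext x
    simp [ext, Equiv.funSplitAt, x.2]
  let N (i : {x // x ≠ u} → Fin n) : Finset (Fin n) :=
    Finset.univ.filter fun j => (a u, j) ∈ gluedEdges a' b' i
  let h (i : {x // x ≠ u} → Fin n) : ℂ :=
    ∑ j ∈ N i, (wordWeight κ a b (ext i j) - wordWeight κ a' b' i)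
  -- A loop at a column not adjacent to `a u` creates a fresh edge of weight `κ 1 1 = 1`. Only the
  -- adjacent columns, collected in `h i`, deviate from the reduced weight.
  have hsplit : wordSum κ a b n - (n + D) * wordSum κ a' b' n =
      ∑ i, (h i - D * wordWeight κ a' b' i) := by
    have h1 : wordSum κ a b n = ∑ i, ∑ j, wordWeight κ a b (ext i j) := by
      rw [wordSum, ← (Equiv.funSplitAt u (Fin n)).symm.sum_comp, Fintype.sum_prod_type_right]
    have h2 (i) : ∑ j, wordWeight κ a b (ext i j) = n * wordWeight κ a' b' i + h i := by
      have h3 : ∑ j, (wordWeight κ a b (ext i j) - wordWeight κ a' b' i) = h i := by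
        refine (Finset.sum_subset (Finset.subset_univ _) fun j _ hj => ?_).symm
        rw [sub_eq_zero, wordWeight_loop_of_notMem hκ hu, hext]
        rw [hext, hextu]
        exact fun hmem => hj (Finset.mem_filter.2 ⟨Finset.mem_univ _, hmem⟩)
      rw [← h3, Finset.sum_sub_distrib]
      simp
    rw [h1, Finset.sum_congr rfl fun i _ => h2 i, Finset.sum_add_distrib, Finset.sum_sub_distrib,
      ← Finset.mul_sum, ← Finset.mul_sum, wordSum]
    ring
  have hNcard (i) : (N i).card ≤ Fintype.card U := by
    have : N i ⊆ Finset.univ.image i := by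
      intro j hj
      have := (Finset.mem_filter.1 hj).2
      simp only [gluedEdges, Finset.mem_union, Finset.mem_image, Prod.mk.injEq] at this
      obtain ⟨x, -, -, hx⟩ | ⟨x, -, -, hx⟩ := this <;>
      exact Finset.mem_image.2 ⟨x, Finset.mem_univ _, hx⟩
    refine (Finset.card_le_card this).trans (Finset.card_image_le.trans ?_)
    rw [Finset.card_univ]
    omega
  have hbound (i) : ‖h i - D * wordWeight κ a' b' i‖ ≤ C₁ := by
    refine (norm_sub_le _ _).trans (add_le_add ?_ ?_)
    · refine (norm_sum_le_of_le _ fun j _ => (norm_sub_le _ _).trans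
        (add_le_add (norm_wordWeight_le hK hκ le_rfl a b _) (hw' i))).trans ?_
      rw [Finset.sum_const, nsmul_eq_mul]
      exact mul_le_mul_of_nonneg_right (by exact_mod_cast hNcard i) (by positivity)
    · rw [norm_mul]
      exact mul_le_mul_of_nonneg_left (hw' i) (norm_nonneg _)
  -- By the dichotomy the error lives on words with fewer than `r` columns, which gains one power of
  -- `n`.
  have hsupp (i) (hi : h i - D * wordWeight κ a' b' i ≠ 0) : (Finset.univ.image i).card < r := by
    by_contra hlt
    refine hi (sub_eq_zero.2 ?_)
    exact wordWeight_loop_dichotomy hκ hu hl hbal hn i (by omega)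
  rw [hsplit]
  have hC₁ : 0 ≤ C₁ := by positivity
  -- The factor `n` on the left of the claim avoids the exponent `r - 1`; for `r = 0` the error
  -- vanishes identically.
  rcases Nat.eq_zero_or_pos r with rfl | hr0
  · rw [Finset.sum_eq_zero fun i _ => by_contra fun hi => Nat.not_lt_zero _ (hsupp i hi)]
    simp only [norm_zero, zero_mul]
    positivity
  · have := norm_sum_le_of_card_image hn hC₁ _ hbound (r := r - 1)
      (fun i hi => Nat.le_sub_one_of_lt (hsupp i hi))
    calc _ ≤ C₁ * ((r - 1 : ℕ) ^ Fintype.card {x // x ≠ u} * n ^ (r - 1)) * (n : ℝ) :=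
          mul_le_mul_of_nonneg_right this (by positivity)
      _ = C₁ * ((r - 1 : ℕ) ^ Fintype.card {x // x ≠ u}) * (n ^ (r - 1) * n) := by ring
      _ = _ := by rw [← pow_succ, Nat.sub_add_cancel hr0]

end Loop

/-! ### Removing loops and contracting vertices of tree words -/

section Reduction

variable {U S J : Type*} [Fintype U] [DecidableEq S] [DecidableEq J]

theorem card_subtype_ne_add_one {X : Type*} [Fintype X] [DecidableEq X] (x₀ : X) :
    Fintype.card {x // x ≠ x₀} + 1 = Fintype.card X := by
  have := Fintype.card_pos_iff.2 ⟨x₀⟩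
  rw [Fintype.card_subtype_compl, Fintype.card_subtype_eq]
  omega

theorem IsTreeWord.exists_right [Fintype S] [Fintype J] {a b : U → S} {i : U → J} (h : IsTreeWord a b i) (u : U) :
    ∃ v, b v = a u ∧ i v = i u := by
  have h1 := (h.edgeCount_eq_one (left_mem_gluedEdges a b i u)).2
  obtain ⟨v, hv⟩ := Finset.card_pos.1 (show 0 < edgeCount b i (a u) (i u) by omega)
  exact ⟨v, (Finset.mem_filter.1 hv).2⟩

variable [DecidableEq U]

/-- The edge `(a u, i u)` is also used in the other direction, by a letter with the same column;
this can only be `u`. -/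
theorem IsTreeWord.loop [Fintype S] [Fintype J] {a b : U → S} {i : U → J} (h : IsTreeWord a b i) {u : U}
    (hu : ∀ x, i x = i u → x = u) :
    a u = b u ∧ IsTreeWord (fun x : {x // x ≠ u} => a x) (fun x => b x)
      (fun x => (⟨i x, fun hx => x.2 (hu x hx)⟩ : {j // j ≠ i u})) := by
  obtain ⟨v, hv1, hv2⟩ := h.exists_right u
  obtain rfl := hu v hv2
  refine ⟨hv1.symm, ⟨h.nonempty, ?_, ?_, ?_, ?_, ?_⟩⟩
  · refine fun f hf => h.linked f fun x => ?_
    by_cases hx : x = v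
    · rw [hx, hv1]
    · exact hf ⟨x, hx⟩
  · intro t
    have := h.balanced t
    rw [card_filter_eq_edgeCount, card_filter_eq_edgeCount, edgeCount_split v a,
      edgeCount_split v b, hv1] at this
    rw [card_filter_eq_edgeCount, card_filter_eq_edgeCount]
    omega
  · rintro ⟨j, hj⟩
    obtain ⟨x, rfl⟩ := h.surjective j
    exact ⟨⟨x, fun hx => hj (by rw [hx])⟩, rfl⟩
  · rintro t ⟨j, hj⟩
    have := h.mult t j
    rw [edgeCount_split v a, edgeCount_split v b, if_neg fun h' => hj h'.2.symm,
      if_neg fun h' => hj h'.2.symm] at this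
    rw [← edgeCount_comp_right Subtype.val_injective, ← edgeCount_comp_right Subtype.val_injective]
    exact this
  · have := h.card
    have := card_subtype_ne_add_one v
    have := card_subtype_ne_add_one (i v)
    omega

/-- Contraction of a vertex with one outgoing arrow `u` and one incoming arrow `v`. -/
structure IsContractible (a b : U → S) (u v : U) : Prop where
  ne : v ≠ u
  left : ∀ x, a x = a u → x = u
  right : ∀ x, b x = a u → x = v
  eq : b v = a u

/-- The source map of the contracted word. -/
def contractLeft {a b : U → S} {u v : U} (h : IsContractible a b u v) :
    {x // x ≠ u} → {s // s ≠ a u} :=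
  fun x => ⟨a x, fun hx => x.2 (h.left x hx)⟩

/-- The target map of the contracted word. -/
def contractRight {a b : U → S} {u v : U} (h : IsContractible a b u v) :
    {x // x ≠ u} → {s // s ≠ a u} :=
  -- The swap hands the target of `u` to `v`: the two arrows through `a u` become one.
  fun x => ⟨b (Equiv.swap u v x), fun hx => x.2 (by
    have := h.right _ hx
    rwa [Equiv.swap_apply_eq_iff, Equiv.swap_apply_right] at this)⟩

variable {a b : U → S} {u v : U}

theorem edgeCount_contractLeft (h : IsContractible a b u v) (i : U → J) (s : {s // s ≠ a u})
    (j : J) : edgeCount (contractLeft h) (fun x : {x // x ≠ u} => i x) s j =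
      edgeCount a i s j := by
  rw [edgeCount_split u a, if_neg fun h' => s.2 h'.1.symm,
    ← edgeCount_comp_left Subtype.val_injective]
  rfl

theorem edgeCount_contractRight (h : IsContractible a b u v) (i : U → J) (hi : i u = i v)
    (s : {s // s ≠ a u}) (j : J) :
    edgeCount (contractRight h) (fun x : {x // x ≠ u} => i x) s j = edgeCount b i s j := by
  rw [← edgeCount_comp_perm (Equiv.swap u v) b i]
  have hi' : i ∘ Equiv.swap u v = i := by
    funext x
    rcases eq_or_ne x u with rfl | hxu
    · simp [hi]
    rcases eq_or_ne x v with rfl | hxv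
    · simp [hi]
    · simp [Equiv.swap_apply_of_ne_of_ne hxu hxv]
  rw [hi', edgeCount_split u (b ∘ Equiv.swap u v), if_neg,
    ← edgeCount_comp_left Subtype.val_injective, add_zero]
  · rfl
  · rintro ⟨h', -⟩
    simp only [Function.comp_apply, Equiv.swap_apply_left, h.eq] at h'
    exact s.2 h'.symm

variable [Fintype S] [Fintype J]

theorem IsTreeWord.contract {i : U → J} (ht : IsTreeWord a b i) (h : IsContractible a b u v)
    (hi : i u = i v) :
    IsTreeWord (contractLeft h) (contractRight h) (fun x : {x // x ≠ u} => i x) := by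
  have hav : a v ≠ a u := fun hv => h.ne (h.left v hv)
  refine ⟨⟨⟨a v, hav⟩⟩, ?_, ?_, ?_, ?_, ?_⟩
  · rintro f hf ⟨s, hs⟩ ⟨s', hs'⟩ hfs
    -- A predicate on the remaining vertices is extended to `a u` by its value at `a v`, the source
    -- of the arrow entering `a u`.
    have key := ht.linked (fun t => f (if ht : t = a u then ⟨a v, hav⟩ else ⟨t, ht⟩)) ?_ s s'
    · simpa [hs, hs', hfs] using key
    intro x
    rcases eq_or_ne x u with rfl | hxu
    · have := hf ⟨v, h.ne⟩
      have hbu : b x ≠ a x := fun hb => h.ne (h.right x hb).symm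
      simpa [contractLeft, contractRight, hbu] using this
    · have hau : a x ≠ a u := fun ha => hxu (h.left x ha)
      rcases eq_or_ne x v with rfl | hxv
      · simp [h.eq, hau]
      · have := hf ⟨x, hxu⟩
        have hbu : b x ≠ a u := fun hb => hxv (h.right x hb)
        simpa [contractLeft, contractRight, hau, hbu,
          Equiv.swap_apply_of_ne_of_ne hxu hxv] using this
  · intro s
    have := ht.balanced s
    rw [card_filter_eq_edgeCount, card_filter_eq_edgeCount] at this ⊢
    rw [← edgeCount_contractLeft h, ← edgeCount_contractRight h (fun _ => ()) rfl] at this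
    exact this
  · intro j
    obtain ⟨x, rfl⟩ := ht.surjective j
    rcases eq_or_ne x u with rfl | hxu
    · exact ⟨⟨v, h.ne⟩, hi.symm⟩
    · exact ⟨⟨x, hxu⟩, rfl⟩
  · intro s j
    rw [edgeCount_contractLeft, edgeCount_contractRight h i hi]
    exact ht.mult s j
  · have := ht.card
    have := card_subtype_ne_add_one u
    have := card_subtype_ne_add_one (a u)
    omega

/-- Only `u` leaves and only `v` enters the vertex. With distinct columns the edge `(a u, i u)` has
weight `κ 1 0 = 0`; with equal ones the vertex carries a single edge of weight `κ 1 1 = 1`. -/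
theorem wordWeight_contract {κ : ℕ → ℕ → ℂ} (hκ : IsStandardMoments κ)
    (h : IsContractible a b u v) (i : U → J) :
    wordWeight κ a b i = if i u = i v then
      wordWeight κ (contractLeft h) (contractRight h) (fun x : {x // x ≠ u} => i x) else 0 := by
  have hca (j : J) : edgeCount a i (a u) j = if i u = j then 1 else 0 := by
    rw [edgeCount]
    have : (Finset.univ.filter fun x => a x = a u ∧ i x = j) =
        if i u = j then {u} else ∅ := by
      ext x
      split_ifs with hj
      · simp only [Finset.mem_filter, Finset.mem_univ, true_and, Finset.mem_singleton]
        exact ⟨fun hx => h.left x hx.1, by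
          rintro rfl
          exact ⟨rfl, hj⟩⟩
      · simp only [Finset.mem_filter, Finset.mem_univ, true_and, Finset.notMem_empty, iff_false]
        rintro ⟨hx, hx'⟩
        exact hj (h.left x hx ▸ hx')
    rw [this]
    split_ifs <;> simp
  have hcb (j : J) : edgeCount b i (a u) j = if i v = j then 1 else 0 := by
    rw [edgeCount]
    have : (Finset.univ.filter fun x => b x = a u ∧ i x = j) =
        if i v = j then {v} else ∅ := by
      ext x
      split_ifs with hj
      · simp only [Finset.mem_filter, Finset.mem_univ, true_and, Finset.mem_singleton]
        exact ⟨fun hx => h.right x hx.1, by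
          rintro rfl
          exact ⟨h.eq, hj⟩⟩
      · simp only [Finset.mem_filter, Finset.mem_univ, true_and, Finset.notMem_empty, iff_false]
        rintro ⟨hx, hx'⟩
        exact hj (h.right x hx ▸ hx')
    rw [this]
    split_ifs <;> simp
  split_ifs with hi
  · rw [wordWeight, wordWeight, Fintype.prod_prod_type, Fintype.prod_prod_type,
      ← Finset.mul_prod_erase _ _ (Finset.mem_univ (a u))]
    have h1 : ∏ j, κ (edgeCount a i (a u) j) (edgeCount b i (a u) j) = 1 := by
      refine Finset.prod_eq_one fun j _ => ?_
      rw [hca, hcb, hi]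
      split_ifs
      · exact hκ.one_one
      · exact hκ.zero_zero
    simp only
    rw [h1, one_mul, Finset.prod_subtype (p := fun s => s ≠ a u) _ (by simp)]
    refine Finset.prod_congr rfl fun s _ => Finset.prod_congr rfl fun j _ => ?_
    rw [edgeCount_contractLeft, edgeCount_contractRight h i hi]
  · refine Finset.prod_eq_zero (Finset.mem_univ (a u, i u)) ?_
    simp only
    rw [hca, hcb, if_pos rfl, if_neg fun h' => hi h'.symm]
    exact hκ.one_zero

theorem wordSum_contract {κ : ℕ → ℕ → ℂ} (hκ : IsStandardMoments κ)
    (h : IsContractible a b u v) (n : ℕ) :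
    wordSum κ a b n = wordSum κ (contractLeft h) (contractRight h) n := by
  rw [wordSum, wordSum, ← (Equiv.funSplitAt u (Fin n)).symm.sum_comp, Fintype.sum_prod_type_right]
  refine Finset.sum_congr rfl fun i _ => ?_
  rw [Finset.sum_eq_single (i ⟨v, h.ne⟩)]
  · rw [wordWeight_contract hκ h, if_pos (by simp [Equiv.funSplitAt, h.ne])]
    congr 1
    funext x
    simp [Equiv.funSplitAt, x.2]
  · intro j _ hj
    rw [wordWeight_contract hκ h, if_neg]
    simpa [Equiv.funSplitAt, h.ne] using hj
  · exact fun h => absurd (Finset.mem_univ _) h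

end Reduction

/-- A tree word with letters has a column that occurs once, or a vertex with one arrow in each
direction. -/
theorem IsTreeWord.exists_reduction {U S J : Type*} [Fintype U] [DecidableEq U] [DecidableEq S]
    [DecidableEq J] [Fintype S] [Fintype J] {a b : U → S} {i : U → J} (h : IsTreeWord a b i)
    (hU : Nonempty U) :
    (∃ u, ∀ x, i x = i u → x = u) ∨ ∃ u v, IsContractible a b u v ∧ i u = i v := by
  by_contra hcon
  rw [not_or] at hcon
  obtain ⟨h1, h2⟩ := hcon
  have hsur {s} : ∃ x, a x = s := by
    obtain ⟨x₀⟩ := hU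
    have := h.linked (fun s => ∃ x, a x = s) (fun x => ?_) (a x₀) s ⟨x₀, rfl⟩
    · exact this
    · refine ⟨fun _ => ?_, fun _ => ⟨x, rfl⟩⟩
      have hb : 0 < (Finset.univ.filter fun y => b y = b x).card :=
        Finset.card_pos.2 ⟨x, by simp⟩
      rw [← h.balanced, Finset.card_pos] at hb
      obtain ⟨y, hy⟩ := hb
      exact ⟨y, (Finset.mem_filter.1 hy).2⟩
  have hJ (j : J) : 2 ≤ (Finset.univ.filter fun x => i x = j).card := by
    obtain ⟨u, rfl⟩ := h.surjective j
    by_contra hlt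
    refine h1 ⟨u, fun x hx => ?_⟩
    exact Finset.card_le_one.1 (Nat.le_of_lt_succ (not_le.1 hlt)) x (by simp [hx]) u (by simp)
  have hS (s : S) : 2 ≤ (Finset.univ.filter fun x => a x = s).card := by
    obtain ⟨u, rfl⟩ := hsur (s := s)
    by_contra hlt
    have hlt := Nat.le_of_lt_succ (not_le.1 hlt)
    have hleft (x) (hx : a x = a u) : x = u :=
      Finset.card_le_one.1 hlt x (by simp [hx]) u (by simp)
    have hlt' := h.balanced (a u) ▸ hlt
    obtain ⟨v, hv1, hv2⟩ := h.exists_right u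
    have hright (x) (hx : b x = a u) : x = v :=
      Finset.card_le_one.1 hlt' x (by simp [hx]) v (by simp [hv1])
    -- If `v = u`, the only arrow at this vertex is a loop; by connectedness there is no other
    -- vertex, hence no other letter.
    rcases eq_or_ne v u with rfl | hvu
    · refine h1 ⟨v, fun x _ => hleft x ?_⟩
      have := h.linked (fun s => s = a v) (fun y => ?_) (a v) (a x) rfl
      · exact this
      · refine ⟨fun hy => ?_, fun hy => ?_⟩
        · rw [hleft y hy, hv1]
        · rw [hright y hy]
    · exact h2 ⟨u, v, ⟨hvu, hleft, hright, hv1⟩, hv2.symm⟩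
  have hsS : Fintype.card U = ∑ s, (Finset.univ.filter fun x => a x = s).card := by
    rw [← Finset.card_univ]
    exact Finset.card_eq_sum_card_fiberwise fun _ _ => Finset.mem_univ _
  have hsJ : Fintype.card U = ∑ j, (Finset.univ.filter fun x => i x = j).card := by
    rw [← Finset.card_univ]
    exact Finset.card_eq_sum_card_fiberwise fun _ _ => Finset.mem_univ _
  -- If no reduction exists, every vertex and every column occurs at least twice, so `S` and `J`
  -- together have at most as many elements as `U`; a tree word has one more.
  have e1 := Finset.card_nsmul_le_sum Finset.univ _ 2 fun s _ => hS s
  have e2 := Finset.card_nsmul_le_sum Finset.univ _ 2 fun j _ => hJ j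
  rw [← hsS, Finset.card_univ, smul_eq_mul] at e1
  rw [← hsJ, Finset.card_univ, smul_eq_mul] at e2
  have := h.card
  omega

/-- Two-term asymptotics of `wordSum` for tree words. -/
theorem IsTreeWord.wordSum_asymptotics {κ : ℕ → ℕ → ℂ} (hκ : IsStandardMoments κ) (N : ℕ) :
    ∀ {U S J : Type} [Fintype U] [DecidableEq U] [DecidableEq S] [DecidableEq J] [Fintype S]
      [Fintype J] {a b : U → S} {i : U → J}, IsTreeWord a b i → Fintype.card U = N →
      ∃ C : ℝ, ∀ n : ℕ, 1 ≤ n →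
        ‖wordSum κ a b n / n ^ Fintype.card J -
          (1 + (κ 2 2 - 1) *
            (∑ s, (Finset.univ.filter fun x => a x = s).card.choose 2 : ℕ) / n)‖ ≤
          C / (n : ℝ) ^ 2 := by
  induction N with
  | zero =>
    intro U S J _ _ _ _ _ _ a b i h hU
    have hUe := Fintype.card_eq_zero_iff.1 hU
    refine ⟨0, fun n _ => ?_⟩
    have hJ : Fintype.card J = 0 :=
      Fintype.card_eq_zero_iff.2 ⟨fun j => hUe.elim (h.surjective j).choose⟩
    have h1 (i : U → Fin n) : wordWeight κ a b i = 1 :=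
      Finset.prod_eq_one fun e _ => by simp [edgeCount, hκ.zero_zero]
    simp [wordSum, h1, hJ]
  | succ N ih =>
    intro U S J _ _ _ _ _ _ a b i h hU
    obtain ⟨u, hu⟩ | ⟨u, v, hc, hi⟩ :=
      h.exists_reduction (Fintype.card_pos_iff.1 (by omega))
    · obtain ⟨hab, h'⟩ := h.loop hu
      have hUc := card_subtype_ne_add_one u
      have hJc := card_subtype_ne_add_one (i u)
      have := h.nonempty
      obtain ⟨C₀, hC₀⟩ := ih h' (by omega)
      obtain ⟨C₁, hC₁⟩ := wordSum_loop hκ hab h'.linked h'.balanced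
        (r := Fintype.card {j // j ≠ i u}) (by have := h'.card; omega)
      set a' : {x // x ≠ u} → S := fun x => a x
      set b' : {x // x ≠ u} → S := fun x => b x
      set r := Fintype.card {j // j ≠ i u}
      set d : ℕ := (Finset.univ.filter fun x : {x // x ≠ u} => a x = a u).card
      -- Pascal's rule: the loop raises the degree of `a u` from `d` to `d + 1`.
      have hdeg : ∑ s, (Finset.univ.filter fun x => a x = s).card.choose 2 =
          ∑ s, (Finset.univ.filter fun x => a' x = s).card.choose 2 + d := by
        have h1 (s : S) : (Finset.univ.filter fun x => a x = s).card =
            (Finset.univ.filter fun x => a' x = s).card + if a u = s then 1 else 0 := by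
          rw [card_filter_eq_edgeCount, card_filter_eq_edgeCount, edgeCount_split u]
          simp [a']
        have h2 (s : S) : (Finset.univ.filter fun x => a x = s).card.choose 2 =
            (Finset.univ.filter fun x => a' x = s).card.choose 2 +
              if a u = s then d else 0 := by
          rw [h1]
          split_ifs with hs
          · subst hs
            rw [Nat.choose_succ_succ' _ 1, Nat.choose_one_right, add_comm]
          · rfl
        rw [Finset.sum_congr rfl fun s _ => h2 s, Finset.sum_add_distrib]
        simp
      rw [hdeg]
      set e' : ℕ := ∑ s, (Finset.univ.filter fun x => a' x = s).card.choose 2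
      set z : ℂ := κ 2 2 - 1
      refine ⟨C₀ + ‖d * z‖ * (‖z * e'‖ + C₀) + C₁, fun n hn => ?_⟩
      have hn0 : (n : ℂ) ≠ 0 := Nat.cast_ne_zero.2 (by omega)
      have hn0' : (0 : ℝ) < n := by exact_mod_cast hn
      have hn1 : (1 : ℝ) ≤ n := by exact_mod_cast hn
      have k0 := hC₀ n hn
      have k1 := hC₁ n hn
      set W := wordSum κ a b n
      set W' := wordSum κ a' b' n
      set x : ℂ := W' / n ^ r
      set err : ℂ := W - (n + d * z) * W'
      have hJr : Fintype.card J = r + 1 := hJc.symm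
      -- Three errors, each of order `n ^ (-2)`: that of the reduced word, the product of the two
      -- first-order corrections, and that of removing the loop.
      have hid : W / n ^ Fintype.card J - (1 + z * (e' + d : ℕ) / n) =
          (x - (1 + z * e' / n)) + d * z / n * ((x - (1 + z * e' / n)) + z * e' / n) +
            err / n ^ (r + 1) := by
        rw [hJr]
        simp only [x, err]
        push_cast
        field_simp
        ring
      have hC₀0 : 0 ≤ C₀ := by
        have := (norm_nonneg _).trans (hC₀ 1 le_rfl)
        simpa using this
      have b2 : ‖(d : ℂ) * z / n * ((x - (1 + z * e' / n)) + z * e' / n)‖ ≤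
          ‖d * z‖ * (‖z * e'‖ + C₀) / (n : ℝ) ^ 2 := by
        rw [norm_mul, norm_div, Complex.norm_natCast]
        have : ‖(x - (1 + z * e' / n)) + z * e' / n‖ ≤ (‖z * e'‖ + C₀) / n := by
          refine (norm_add_le _ _).trans ?_
          rw [norm_div (z * e'), Complex.norm_natCast, add_div, add_comm]
          refine add_le_add le_rfl (k0.trans ?_)
          exact div_le_div_of_nonneg_left hC₀0 hn0' (le_self_pow₀ hn1 (by norm_num))
        calc _ ≤ ‖(d : ℂ) * z‖ / n * ((‖z * e'‖ + C₀) / n) :=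
              mul_le_mul_of_nonneg_left this (by positivity)
          _ = _ := by field_simp
      have b3 : ‖err / (n : ℂ) ^ (r + 1)‖ ≤ C₁ / (n : ℝ) ^ 2 := by
        rw [norm_div, norm_pow, Complex.norm_natCast, div_le_div_iff₀ (by positivity)
          (by positivity)]
        calc ‖err‖ * (n : ℝ) ^ 2 = ‖err‖ * n * n := by ring
          _ ≤ C₁ * n ^ r * n := mul_le_mul_of_nonneg_right k1 hn0'.le
          _ = _ := by ring
      rw [hid, add_div, add_div]
      exact (norm_add₃_le).trans (add_le_add_three k0 b2 b3)
    · have h' := h.contract hc hi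
      have hUc := card_subtype_ne_add_one u
      obtain ⟨C, hC⟩ := ih h' (by omega)
      refine ⟨C, fun n hn => ?_⟩
      -- The contracted vertex has degree one and adds nothing; the other degrees are unchanged.
      have hdeg : ∑ s, (Finset.univ.filter fun x => a x = s).card.choose 2 =
          ∑ s, (Finset.univ.filter fun x => contractLeft hc x = s).card.choose 2 := by
        rw [← Finset.add_sum_erase _ _ (Finset.mem_univ (a u)),
          Finset.sum_subtype (p := fun s => s ≠ a u) _ (by simp)]
        have h0 : (Finset.univ.filter fun x => a x = a u).card.choose 2 = 0 := by
          refine Nat.choose_eq_zero_of_lt (Nat.lt_succ_of_le (Finset.card_le_one.2 ?_))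
          intro x hx y hy
          rw [hc.left x (Finset.mem_filter.1 hx).2, hc.left y (Finset.mem_filter.1 hy).2]
        rw [h0, zero_add]
        refine Finset.sum_congr rfl fun s _ => ?_
        rw [card_filter_eq_edgeCount, card_filter_eq_edgeCount, ← edgeCount_contractLeft hc]
      rw [hdeg, wordSum_contract hκ hc]
      exact hC n hn

/-! ### Canonical sequences -/

/-- The values taken before any position form an initial segment: a term cannot skip a number. -/
theorem IsCanonical.exists_lt_of_lt_sup {p s : ℕ} {α : Fin p → Fin s} (h : IsCanonical α)
    (u : Fin p) : ∀ x : ℕ, x < (Finset.univ.filter fun v : Fin p => v < u).sup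
      (fun v => (α v : ℕ) + 1) → ∃ v < u, (α v : ℕ) = x := by
  induction u using WellFoundedLT.induction with
  | ind u ih =>
    intro x hx
    obtain ⟨w, hw, hxw⟩ := Finset.lt_sup_iff.1 hx
    have hw := (Finset.mem_filter.1 hw).2
    rcases Nat.lt_succ_iff_lt_or_eq.1 hxw with hlt | heq
    · obtain ⟨v, hv, hvx⟩ := ih w hw x (hlt.trans_le (h.2 w))
      exact ⟨v, hv.trans hw, hvx⟩
    · exact ⟨w, hw, heq.symm⟩

/-- Each term either repeats an earlier one, which the kernel detects, or is the smallest unused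
number. -/
theorem IsCanonical.val_eq {p s s' : ℕ} {α : Fin p → Fin s} {α' : Fin p → Fin s'}
    (h : IsCanonical α) (h' : IsCanonical α') (hker : ∀ u v, α u = α v ↔ α' u = α' v)
    (u : Fin p) : (α u : ℕ) = α' u := by
  induction u using WellFoundedLT.induction with
  | ind u ih =>
    have hsup : (Finset.univ.filter fun v : Fin p => v < u).sup (fun v => (α v : ℕ) + 1) =
        (Finset.univ.filter fun v : Fin p => v < u).sup (fun v => (α' v : ℕ) + 1) :=
      Finset.sup_congr rfl fun v hv => by rw [ih v (Finset.mem_filter.1 hv).2]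
    have h1 := h.2 u
    have h1' := h'.2 u
    have h2 := h.exists_lt_of_lt_sup u (α u)
    have h2' := h'.exists_lt_of_lt_sup u (α' u)
    rw [← hsup] at h1' h2'
    rcases h1.lt_or_eq with hlt | heq
    · obtain ⟨v, hv, hvu⟩ := h2 hlt
      have := (hker v u).1 (Fin.ext hvu)
      rw [← hvu, ih v hv, this]
    · rcases h1'.lt_or_eq with hlt | heq'
      · obtain ⟨v, hv, hvu⟩ := h2' hlt
        have := (hker v u).2 (Fin.ext hvu)
        rw [← hvu, ← ih v hv, this]
      · rw [heq, heq']

theorem IsCanonical.le_of_val_eq {p s s' : ℕ} {α : Fin p → Fin s} {α' : Fin p → Fin s'}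
    (h : IsCanonical α) (hval : ∀ u, (α u : ℕ) = α' u) : s ≤ s' := by
  by_contra hlt
  obtain ⟨u, hu⟩ := h.1 ⟨s', not_le.1 hlt⟩
  have h1 := hval u
  rw [hu] at h1
  exact absurd (α' u).2 (by rw [← h1]; exact lt_irrefl _)

theorem exists_isCanonical_comp {p : ℕ} {X : Type*} (f : Fin p → X) :
    ∃ (s : ℕ) (α : Fin p → Fin s) (φ : Fin s → X),
      IsCanonical α ∧ φ.Injective ∧ f = φ ∘ α := by
  classical
  -- The positions where a new value appears; values are numbered in the order of these positions.
  let F : Finset (Fin p) := Finset.univ.filter fun w => ∀ v, f v = f w → w ≤ v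
  have hne (u : Fin p) : (Finset.univ.filter fun v => f v = f u).Nonempty := ⟨u, by simp⟩
  let first (u : Fin p) : Fin p := (Finset.univ.filter fun v => f v = f u).min' (hne u)
  have hf_first (u : Fin p) : f (first u) = f u :=
    (Finset.mem_filter.1 (Finset.min'_mem _ (hne u))).2
  have hfirst_le (u v : Fin p) (h : f v = f u) : first u ≤ v :=
    Finset.min'_le _ _ (by simp [h])
  have hmem (u : Fin p) : first u ∈ F := by
    simp only [F, Finset.mem_filter, Finset.mem_univ, true_and]
    intro v hv
    exact hfirst_le u v (hv.trans (hf_first u))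
  have hF {w v : Fin p} (hw : w ∈ F) (h : f v = f w) : w ≤ v := (Finset.mem_filter.1 hw).2 v h
  have hfix {w : Fin p} (hw : w ∈ F) : first w = w :=
    le_antisymm (hfirst_le w w rfl) (hF hw (hf_first w))
  let e := F.orderIsoOfFin rfl
  let α : Fin p → Fin F.card := fun u => e.symm ⟨first u, hmem u⟩
  have hα (x : Fin F.card) : α (e x) = x := by
    simp only [α]
    rw [OrderIso.symm_apply_eq]
    exact Subtype.ext (hfix (e x).2)
  refine ⟨F.card, α, fun x => f (e x), ⟨fun x => ⟨e x, hα x⟩, fun u => ?_⟩, ?_, ?_⟩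
  · rcases Nat.eq_zero_or_pos (α u : ℕ) with h0 | hpos
    · omega
    · let y : Fin F.card := ⟨(α u : ℕ) - 1, by omega⟩
      have hy : (y : ℕ) + 1 = α u := Nat.sub_add_cancel hpos
      have hlt : (e y : Fin p) < u := by
        refine lt_of_lt_of_le ?_ (hfirst_le u u rfl)
        have : e y < e (α u) := e.lt_iff_lt.2 (Fin.lt_def.2 (by omega))
        rwa [OrderIso.apply_symm_apply] at this
      refine le_trans (le_of_eq ?_) (Finset.le_sup (f := fun v => (α v : ℕ) + 1)
        (Finset.mem_filter.2 ⟨Finset.mem_univ _, hlt⟩))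
      rw [hα, hy]
  · intro x y hxy
    exact e.injective (Subtype.ext (le_antisymm (hF (e x).2 hxy.symm) (hF (e y).2 hxy)))
  · funext u
    simp [α, hf_first]

open Classical in
/-- The canonical `s`-sequences of length `p`. -/
noncomputable def canonicalAll (s p : ℕ) : Finset (Fin p → Fin s) :=
  Finset.univ.filter IsCanonical

open Classical in
/-- The injections of `Fin s` into `Fin m`. -/
noncomputable def injections (s m : ℕ) : Finset (Fin s → Fin m) :=
  Finset.univ.filter Function.Injective

theorem mem_canonicalAll {s p : ℕ} {α : Fin p → Fin s} : α ∈ canonicalAll s p ↔ IsCanonical α := by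
  simp [canonicalAll]

theorem mem_injections {s m : ℕ} {φ : Fin s → Fin m} : φ ∈ injections s m ↔ φ.Injective := by
  simp [injections]

theorem mem_canonicalOne {s p : ℕ} {α : Fin p → Fin s} : α ∈ canonicalOne s p ↔
    IsCanonical α ∧ ∃ i : Fin p → Fin (p + 1 - s), IsCanonical i ∧ IsDelta1 α i := by
  simp [canonicalOne]

theorem IsCanonical.le {p s : ℕ} {α : Fin p → Fin s} (h : IsCanonical α) : s ≤ p := by
  simpa using Fintype.card_le_of_surjective α h.1

theorem IsCanonical.one_le {p s : ℕ} {α : Fin p → Fin s} (_h : IsCanonical α) (hp : 1 ≤ p) :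
    1 ≤ s :=
  Fin.pos (α ⟨0, hp⟩)

/-- Sorting the functions on `Fin p` by their kernels. -/
theorem sum_eq_sum_canonicalAll {M : Type*} [AddCommMonoid M] (p m : ℕ)
    (h : (Fin p → Fin m) → M) :
    ∑ f, h f = ∑ s ∈ Finset.range (p + 1), ∑ α ∈ canonicalAll s p, ∑ φ ∈ injections s m,
      h (φ ∘ α) := by
  rw [Finset.sum_congr rfl fun s _ => Finset.sum_sigma' (canonicalAll s p)
    (fun _ => injections s m) (fun α φ => h (φ ∘ α)), Finset.sum_sigma']
  symm
  refine Finset.sum_bij (fun x _ => x.2.2 ∘ x.2.1) (fun _ _ => Finset.mem_univ _) ?_ ?_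
    fun _ _ => rfl
  · rintro ⟨s, α, φ⟩ hx ⟨s', α', φ'⟩ hx' heq
    simp only [Finset.mem_sigma, Finset.mem_range, mem_canonicalAll, mem_injections] at hx hx'
    obtain ⟨-, hα, hφ⟩ := hx
    obtain ⟨-, hα', hφ'⟩ := hx'
    simp only at heq
    -- Both sequences have the kernel of the common composite, so they agree; surjectivity then
    -- recovers the injection.
    have hval := hα.val_eq hα' fun u v => by
      rw [← hφ.eq_iff, ← hφ'.eq_iff]
      change (φ ∘ α) u = (φ ∘ α) v ↔ (φ' ∘ α') u = (φ' ∘ α') v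
      rw [heq]
    obtain rfl := le_antisymm (hα.le_of_val_eq hval) (hα'.le_of_val_eq fun u => (hval u).symm)
    obtain rfl : α = α' := funext fun u => Fin.ext (hval u)
    obtain rfl := hα.1.injective_comp_right heq
    rfl
  · intro f _
    obtain ⟨s, α, φ, hα, hφ, rfl⟩ := exists_isCanonical_comp f
    refine ⟨⟨s, α, φ⟩, ?_, rfl⟩
    simp only [Finset.mem_sigma, Finset.mem_range, mem_canonicalAll, mem_injections]
    exact ⟨Nat.lt_succ_of_le hα.le, hα, hφ⟩

/-! ### Cyclic words and the class `Δ₁` -/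

theorem iff_of_forall_iff_finRotate {p : ℕ} {f : Fin p → Prop}
    (hf : ∀ u, f u ↔ f (finRotate p u)) (u v : Fin p) : f u ↔ f v := by
  cases p with
  | zero => exact u.elim0
  | succ q =>
    have key (u : Fin (q + 1)) : f u ↔ f 0 := by
      induction u using Fin.induction with
      | zero => rfl
      | succ u ih =>
        have := hf u.castSucc
        simp only [finRotate_apply, Fin.coeSucc_eq_succ] at this
        exact this.symm.trans ih
    exact (key u).trans (key v).symm

theorem linked_finRotate {p : ℕ} {S : Type*} {α : Fin p → S} (h : α.Surjective) :
    Linked α (α ∘ finRotate p) := by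
  intro f hf x y hx
  obtain ⟨u, rfl⟩ := h x
  obtain ⟨v, rfl⟩ := h y
  exact (iff_of_forall_iff_finRotate (f := fun u => f (α u)) hf u v).1 hx

theorem balanced_comp_perm {U S : Type*} [Fintype U] [DecidableEq S] (a : U → S)
    (σ : Equiv.Perm U) : Balanced a (a ∘ σ) :=
  fun _ => (Finset.card_equiv σ (by simp)).symm

theorem gluedGraph_eq {p s r : ℕ} (α : Fin p → Fin s) (i : Fin p → Fin r) :
    gluedGraph α i = bipartiteGraph (gluedEdges α (α ∘ finRotate p) i) := by
  ext v w
  rw [gluedGraph, bipartiteGraph, SimpleGraph.fromRel_adj, SimpleGraph.fromRel_adj]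
  refine and_congr_right fun _ => ?_
  simp only [gluedEdges, Finset.mem_union, Finset.mem_image, Finset.mem_univ, true_and,
    Function.comp_apply]
  constructor
  · rintro (⟨u, ⟨rfl, rfl⟩ | ⟨rfl, rfl⟩⟩ | ⟨u, ⟨rfl, rfl⟩ | ⟨rfl, rfl⟩⟩)
    · exact Or.inl ⟨_, Or.inl ⟨u, rfl⟩, rfl, rfl⟩
    · exact Or.inr ⟨_, Or.inr ⟨u, rfl⟩, rfl, rfl⟩
    · exact Or.inr ⟨_, Or.inl ⟨u, rfl⟩, rfl, rfl⟩
    · exact Or.inl ⟨_, Or.inr ⟨u, rfl⟩, rfl, rfl⟩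
  · rintro (⟨_, ⟨u, rfl⟩ | ⟨u, rfl⟩, rfl, rfl⟩ | ⟨_, ⟨u, rfl⟩ | ⟨u, rfl⟩, rfl, rfl⟩)
    · exact Or.inl ⟨u, Or.inl ⟨rfl, rfl⟩⟩
    · exact Or.inr ⟨u, Or.inr ⟨rfl, rfl⟩⟩
    · exact Or.inr ⟨u, Or.inl ⟨rfl, rfl⟩⟩
    · exact Or.inl ⟨u, Or.inr ⟨rfl, rfl⟩⟩

theorem isTreeWord_of_isDelta1 {p s : ℕ} (hp : 1 ≤ p) {α : Fin p → Fin s} (hα : IsCanonical α)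
    {i : Fin p → Fin (p + 1 - s)} (hi : i.Surjective) (h : IsDelta1 α i) :
    IsTreeWord α (α ∘ finRotate p) i := by
  obtain ⟨-, hT, -⟩ := h
  rw [gluedGraph_eq] at hT
  refine ⟨⟨α ⟨0, hp⟩⟩, linked_finRotate hα.1, balanced_comp_perm _ _, hi, fun t j => ?_, ?_⟩
  · have := edgeCount_eq_of_isTree (balanced_comp_perm α (finRotate p)) hT t j
    omega
  · have := hα.le
    simp only [Fintype.card_fin]
    omega

/-- A surviving word with the maximal number of columns is a tree with doubled edges. Renumbering
its columns in order of appearance gives the canonical witness. -/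
theorem mem_canonicalOne_of_wordWeight_ne_zero {κ : ℕ → ℕ → ℂ} (hκ : IsStandardMoments κ)
    {p s n : ℕ} (hp : 1 ≤ p) {α : Fin p → Fin s} (hα : IsCanonical α) {i : Fin p → Fin n}
    (hw : wordWeight κ α (α ∘ finRotate p) i ≠ 0)
    (hcard : p + 1 ≤ s + (Finset.univ.image i).card) : α ∈ canonicalOne s p := by
  have : Nonempty (Fin s) := ⟨α ⟨0, hp⟩⟩
  obtain ⟨r, γ, φ, hγ, hφ, rfl⟩ := exists_isCanonical_comp i
  have hl := linked_finRotate hα.1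
  have hbal := balanced_comp_perm α (finRotate p)
  have hr : (Finset.univ.image (φ ∘ γ)).card = r := by
    rw [← Finset.image_image, Finset.image_univ_of_surjective hγ.1,
      Finset.card_image_of_injective _ hφ, Finset.card_univ, Fintype.card_fin]
  have hle := card_image_le_of_wordWeight_ne_zero hκ hl hw
  rw [wordWeight_comp_right hκ hφ] at hw
  simp only [Fintype.card_fin] at hle
  have hs := hα.le
  obtain rfl : r = p + 1 - s := by omega
  have hT : IsTreeWord α (α ∘ finRotate p) γ := by
    refine ⟨this, hl, hbal, hγ.1, fun t j => ?_, ?_⟩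
    · by_cases htj : (t, j) ∈ gluedEdges α (α ∘ finRotate p) γ
      · have := two_le_of_wordWeight_ne_zero hκ hw htj
        omega
      · have := edgeCount_eq_zero htj
        omega
    · simp only [Fintype.card_fin]
      omega
  have hE : (gluedEdges α (α ∘ finRotate p) γ).card = p := by
    have h1 := sum_gluedEdges_edgeCount α (α ∘ finRotate p) γ
    rw [Finset.sum_congr rfl (g := fun _ => 2) fun e he => by
      rw [(hT.edgeCount_eq_one he).1, (hT.edgeCount_eq_one he).2]] at h1
    simp at h1
    omega
  refine mem_canonicalOne.2 ⟨hα, γ, hγ, fun u => ?_, ?_, ?_⟩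
  · have h1 := (hT.edgeCount_eq_one (left_mem_gluedEdges _ _ _ u)).2
    obtain ⟨v, hv⟩ := Finset.card_eq_one.1 h1
    simp only [Finset.ext_iff, Finset.mem_filter, Finset.mem_univ, true_and,
      Finset.mem_singleton, Function.comp_apply] at hv
    exact ⟨v, (hv v).2 rfl, fun w hw => (hv w).1 hw⟩
  · rw [gluedGraph_eq]
    refine isTree_bipartiteGraph hl hγ.1 ?_
    rw [hE]
    simp only [Fintype.card_fin]
    omega
  · rw [gluedGraph_eq, ncard_edgeSet_bipartiteGraph, hE]

/-! ### Limits of word sums -/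

/-- From `n * (A n - 1) → e` follows `n * log (A n) → e`; the exponent is `k n / n → d` times this.
-/
theorem tendsto_pow_of_norm_sub_le {k : ℕ → ℕ} {d C : ℝ} {A : ℕ → ℂ} {e : ℂ}
    (hk : Tendsto (fun n : ℕ => (k n : ℝ) / (n : ℝ)) atTop (𝓝 d))
    (hA : ∀ n : ℕ, 1 ≤ n → ‖A n - (1 + e / n)‖ ≤ C / (n : ℝ) ^ 2) :
    Tendsto (fun n => A n ^ k n) atTop (𝓝 (Complex.exp (d * e))) := by
  have hg : Tendsto (fun n : ℕ => (n : ℂ) * (A n - 1)) atTop (𝓝 e) := by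
    rw [tendsto_iff_norm_sub_tendsto_zero]
    refine squeeze_zero' (Eventually.of_forall fun _ => norm_nonneg _) ?_
      (tendsto_const_div_atTop_nhds_zero_nat C)
    filter_upwards [eventually_ge_atTop 1] with n hn
    have hn0 : (n : ℂ) ≠ 0 := Nat.cast_ne_zero.2 (by omega)
    have hn0' : (0 : ℝ) < n := by exact_mod_cast hn
    have : (n : ℂ) * (A n - 1) - e = n * (A n - (1 + e / n)) := by
      field_simp
      ring
    rw [this, norm_mul, Complex.norm_natCast]
    calc (n : ℝ) * ‖A n - (1 + e / n)‖ ≤ n * (C / (n : ℝ) ^ 2) :=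
          mul_le_mul_of_nonneg_left (hA n hn) hn0'.le
      _ = C / n := by field_simp
  have hlog := Complex.tendsto_nat_mul_log_one_add_of_tendsto hg
  have hkc : Tendsto (fun n : ℕ => (((k n : ℝ) / (n : ℝ) : ℝ) : ℂ)) atTop (𝓝 (d : ℂ)) :=
    (Complex.continuous_ofReal.tendsto d).comp hk
  have hexp := (Complex.continuous_exp.tendsto _).comp (hkc.mul hlog)
  have hA1 : Tendsto A atTop (𝓝 1) := by
    have h0 : Tendsto (fun n : ℕ => ((n : ℂ))⁻¹ * ((n : ℂ) * (A n - 1)) + 1) atTop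
        (𝓝 (0 * e + 1)) :=
      ((tendsto_inv_atTop_nhds_zero_nat (𝕜 := ℂ)).mul hg).add_const 1
    rw [zero_mul, zero_add] at h0
    refine h0.congr' ?_
    filter_upwards [eventually_ge_atTop 1] with n hn
    have hn0 : (n : ℂ) ≠ 0 := Nat.cast_ne_zero.2 (by omega)
    field_simp
    ring
  refine hexp.congr' ?_
  filter_upwards [eventually_ge_atTop 1, hA1.eventually_ne one_ne_zero] with n hn hne
  have hn0 : (n : ℂ) ≠ 0 := Nat.cast_ne_zero.2 (by omega)
  simp only [Function.comp_apply]
  push_cast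
  rw [add_sub_cancel, ← mul_assoc, div_mul_cancel₀ _ hn0, Complex.exp_nat_mul, Complex.exp_log hne]

theorem tendsto_natCast_of_div {k : ℕ → ℕ} {d : ℝ} (hd : 0 < d)
    (hk : Tendsto (fun n : ℕ => (k n : ℝ) / (n : ℝ)) atTop (𝓝 d)) : Tendsto k atTop atTop := by
  have h := hk.pos_mul_atTop hd tendsto_natCast_atTop_atTop
  refine tendsto_natCast_atTop_iff (R := ℝ).1 (h.congr' ?_)
  filter_upwards [eventually_ge_atTop 1] with n hn
  have hn0 : (n : ℝ) ≠ 0 := Nat.cast_ne_zero.2 (by omega)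
  exact div_mul_cancel₀ _ hn0

theorem tendsto_pow_zero_of_norm_le {k : ℕ → ℕ} {C : ℝ} {A : ℕ → ℂ}
    (hk : Tendsto k atTop atTop) (hA : ∀ n : ℕ, 1 ≤ n → ‖A n‖ ≤ C / n) :
    Tendsto (fun n => A n ^ k n) atTop (𝓝 0) := by
  have h1 : Tendsto (fun n : ℕ => C / (n : ℝ)) atTop (𝓝 0) := tendsto_const_div_atTop_nhds_zero_nat C
  refine squeeze_zero_norm' ?_ h1
  filter_upwards [eventually_ge_atTop 1, hk.eventually_ge_atTop 1,
    h1.eventually_le_const one_pos] with n hn hkn hC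
  rw [norm_pow]
  exact (pow_le_of_le_one (norm_nonneg _) ((hA n hn).trans hC) (by omega)).trans (hA n hn)

/-- Limits of the powers of the normalized word sums of a canonical sequence. -/
theorem tendsto_wordSum_pow {κ : ℕ → ℕ → ℂ} (hκ : IsStandardMoments κ) {k : ℕ → ℕ} {d : ℝ}
    (hd : 0 < d) (hk : Tendsto (fun n : ℕ => (k n : ℝ) / (n : ℝ)) atTop (𝓝 d))
    {p s : ℕ} (hp : 1 ≤ p) {α : Fin p → Fin s} (hα : IsCanonical α) [Decidable (α ∈ canonicalOne s p)] :
    Tendsto (fun n => (wordSum κ α (α ∘ finRotate p) n / n ^ (p + 1 - s)) ^ k n) atTop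
      (𝓝 (if α ∈ canonicalOne s p then
        Complex.exp (d * ((κ 2 2 - 1) * ∑ t, ((deg α t).choose 2 : ℂ))) else 0)) := by
  have : Nonempty (Fin s) := ⟨α ⟨0, hp⟩⟩
  split_ifs with hmem
  · obtain ⟨-, i, hi, hΔ⟩ := mem_canonicalOne.1 hmem
    obtain ⟨C, hC⟩ := (isTreeWord_of_isDelta1 hp hα hi.1 hΔ).wordSum_asymptotics hκ p
      (Fintype.card_fin p)
    refine tendsto_pow_of_norm_sub_le (C := C) hk fun n hn => ?_
    have := hC n hn
    rw [Fintype.card_fin] at this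
    convert! this using 4
    push_cast
    rfl
  · obtain ⟨K, hK⟩ := hκ.exists_momentBound p
    have hs := hα.le
    -- Outside `canonicalOne` every surviving word has at most `p - s` columns, one below the
    -- normalizing exponent.
    refine tendsto_pow_zero_of_norm_le (C := K ^ (2 * p) * (p - s : ℕ) ^ p)
      (tendsto_natCast_of_div hd hk) fun n hn => ?_
    have hn0' : (0 : ℝ) < n := by exact_mod_cast hn
    have hK0 : 0 ≤ K := zero_le_one.trans hK.1
    have hb := norm_sum_le_of_card_image hn (C := K ^ (2 * p)) (pow_nonneg hK0 _)
      (fun i : Fin p → Fin n => wordWeight κ α (α ∘ finRotate p) i)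
      (fun i => by
        have := norm_wordWeight_le hK hκ (by simp) α (α ∘ finRotate p) i
        rwa [Fintype.card_fin] at this) (r := p - s) (fun i hi => by
        by_contra hlt
        exact hmem (mem_canonicalOne_of_wordWeight_ne_zero hκ hp hα hi (by omega)))
    rw [Fintype.card_fin] at hb
    rw [norm_div, norm_pow, Complex.norm_natCast, div_le_div_iff₀ (by positivity) hn0',
      show p + 1 - s = (p - s) + 1 by omega, pow_succ]
    calc ‖wordSum κ α (α ∘ finRotate p) n‖ * (n : ℝ)
        ≤ K ^ (2 * p) * ((p - s : ℕ) ^ p * n ^ (p - s)) * n :=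
          mul_le_mul_of_nonneg_right hb hn0'.le
      _ = _ := by ring

/-! ### Sums over the coefficients -/

/-- The first index is left free, and the cases where it meets one of the others, thereby merging
the exponents, are subtracted. -/
theorem sum_injections_succ (τ : ℕ → ℝ) (s M : ℕ) (q : Fin (s + 1) → ℕ) :
    ∑ φ ∈ injections (s + 1) M, ∏ t, τ (φ t) ^ q t =
      (∑ j ∈ Finset.range M, τ j ^ q 0) * ∑ φ ∈ injections s M, ∏ t, τ (φ t) ^ q t.succ -
        ∑ t₀, ∑ φ ∈ injections s M,
          ∏ t : Fin s, τ (φ t) ^ (q t.succ + if t = t₀ then q 0 else 0) := by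
  classical
  have hinj (j : Fin M) (φ : Fin s → Fin M) :
      Function.Injective ((Fin.consEquiv fun _ => Fin M) (j, φ)) ↔
        j ∉ Finset.univ.image φ ∧ φ.Injective := by
    refine Fin.cons_injective_iff.trans (and_congr_left fun _ => ?_)
    simp
  have hL : ∑ φ ∈ injections (s + 1) M, ∏ t, τ (φ t) ^ q t =
      ∑ φ ∈ injections s M, ∑ j : Fin M,
        if j ∈ Finset.univ.image φ then 0 else τ j ^ q 0 * ∏ t, τ (φ t) ^ q t.succ := by
    rw [injections, Finset.sum_filter, ← (Fin.consEquiv fun _ => Fin M).sum_comp,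
      Fintype.sum_prod_type_right, injections, Finset.sum_filter]
    refine Finset.sum_congr rfl fun φ _ => ?_
    split_ifs with hφ
    · refine Finset.sum_congr rfl fun j _ => ?_
      by_cases hj : j ∈ Finset.univ.image φ
      · rw [if_pos hj, if_neg fun h => ((hinj j φ).1 h).1 hj]
      · rw [if_neg hj, if_pos ((hinj j φ).2 ⟨hj, hφ⟩), Fin.prod_univ_succ]
        rfl
    · exact Finset.sum_eq_zero fun j _ => if_neg fun h => hφ ((hinj j φ).1 h).2
  rw [hL, Finset.sum_comm (s := Finset.univ), Finset.mul_sum, ← Finset.sum_sub_distrib]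
  refine Finset.sum_congr rfl fun φ hφ => ?_
  have hφ := mem_injections.1 hφ
  set A := ∏ t, τ (φ t) ^ q t.succ
  have h1 (t₀ : Fin s) : ∏ t : Fin s, τ (φ t) ^ (q t.succ + if t = t₀ then q 0 else 0) =
      τ (φ t₀) ^ q 0 * A := by
    simp only [pow_add, Finset.prod_mul_distrib, A]
    rw [mul_comm]
    congr 1
    rw [Finset.prod_eq_single t₀ (fun t _ ht => by simp [ht])
      (fun h => absurd (Finset.mem_univ _) h)]
    simp
  have h2 : ∑ j : Fin M, τ j ^ q 0 = ∑ j ∈ Finset.range M, τ j ^ q 0 :=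
    Fin.sum_univ_eq_sum_range (fun j => τ j ^ q 0) M
  rw [Finset.sum_congr rfl fun t₀ _ => h1 t₀, ← h2, Finset.sum_mul]
  have h3 : ∑ t₀, τ (φ t₀) ^ q 0 * A = ∑ j ∈ Finset.univ.image φ, τ j ^ q 0 * A := by
    rw [Finset.sum_image hφ.injOn]
  rw [h3, eq_sub_iff_add_eq, Finset.sum_ite, Finset.sum_const_zero, zero_add, add_comm,
    ← Finset.sum_filter_add_sum_filter_not Finset.univ (fun j => j ∈ Finset.univ.image φ)]
  congr 1
  refine Finset.sum_congr ?_ fun _ _ => rfl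
  ext j
  simp

/-- The collision sums run over only `s` indices, so they lose a factor `1 / M`. -/
theorem tendsto_sum_injections {τ mτ : ℕ → ℝ}
    (hτ : ∀ q : ℕ, 1 ≤ q → Tendsto (fun N : ℕ => (1 / (N : ℝ)) * ∑ j ∈ Finset.range N, τ j ^ q)
      atTop (𝓝 (mτ q))) (s : ℕ) :
    ∀ q : Fin s → ℕ, (∀ t, 1 ≤ q t) →
      Tendsto (fun M : ℕ => (∑ φ ∈ injections s M, ∏ t, τ (φ t) ^ q t) / (M : ℝ) ^ s) atTop
        (𝓝 (∏ t, mτ (q t))) := by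
  induction s with
  | zero =>
    intro q _
    have h (M : ℕ) : injections 0 M = Finset.univ :=
      Finset.eq_univ_of_forall fun φ => mem_injections.2 (Function.injective_of_subsingleton φ)
    simp [h]
  | succ s ih =>
    intro q hq
    have h1 := (hτ (q 0) (hq 0)).mul (ih (fun t => q t.succ) fun t => hq _)
    have h2 : Tendsto (fun M : ℕ => (1 / (M : ℝ)) * ∑ t₀ : Fin s, (∑ φ ∈ injections s M,
        ∏ t : Fin s, τ (φ t) ^ (q t.succ + if t = t₀ then q 0 else 0)) / (M : ℝ) ^ s) atTop
        (𝓝 (0 * ∑ t₀ : Fin s, ∏ t : Fin s, mτ (q t.succ + if t = t₀ then q 0 else 0))) := by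
      refine tendsto_one_div_atTop_nhds_zero_nat.mul (tendsto_finsetSum _ fun t₀ _ => ?_)
      exact ih _ fun t => (hq t.succ).trans (Nat.le_add_right _ _)
    rw [Fin.prod_univ_succ]
    have h3 := h1.sub h2
    rw [zero_mul, sub_zero] at h3
    refine h3.congr fun M => ?_
    rw [sum_injections_succ, sub_div, pow_succ, ← Finset.sum_div]
    congr 1
    · simp only [div_eq_mul_inv, mul_inv, one_mul]
      ring
    · rw [div_mul_div_comm, one_mul, mul_comm (M : ℝ)]

theorem exists_sum_abs_pow_le {τ mτ : ℕ → ℝ}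
    (hτ : ∀ q : ℕ, 1 ≤ q → Tendsto (fun N : ℕ => (1 / (N : ℝ)) * ∑ j ∈ Finset.range N, τ j ^ q)
      atTop (𝓝 (mτ q))) (q : ℕ) :
    ∃ B : ℝ, 0 ≤ B ∧ ∀ M : ℕ, ∑ j : Fin M, |τ j| ^ q ≤ B * M := by
  -- An even exponent removes the absolute values; `q + 1` keeps it positive for `q = 0`.
  obtain ⟨B, hB⟩ := (hτ (2 * (q + 1)) (by omega)).bddAbove_range
  have hpt (x : ℝ) : |x| ^ q ≤ 1 + x ^ (2 * (q + 1)) := by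
    rw [← (even_two_mul (q + 1)).pow_abs]
    rcases le_total |x| 1 with h | h
    · exact (pow_le_one₀ (abs_nonneg x) h).trans (by linarith [pow_nonneg (abs_nonneg x) (2 * (q + 1))])
    · exact (pow_le_pow_right₀ h (by omega : q ≤ 2 * (q + 1))).trans (by linarith)
  refine ⟨1 + max B 0, by positivity, fun M => ?_⟩
  rw [Fin.sum_univ_eq_sum_range (fun j => |τ j| ^ q) M]
  rcases Nat.eq_zero_or_pos M with rfl | hM
  · simp
  have hM0 : (0 : ℝ) < M := by exact_mod_cast hM
  have hB' := hB ⟨M, rfl⟩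
  simp only [one_div_mul_eq_div] at hB'
  rw [div_le_iff₀ hM0] at hB'
  calc ∑ j ∈ Finset.range M, |τ j| ^ q
      ≤ ∑ j ∈ Finset.range M, (1 + τ j ^ (2 * (q + 1))) := Finset.sum_le_sum fun j _ => hpt _
    _ = M + ∑ j ∈ Finset.range M, τ j ^ (2 * (q + 1)) := by simp [Finset.sum_add_distrib]
    _ ≤ M + max B 0 * M := by
        gcongr
        exact hB'.trans (mul_le_mul_of_nonneg_right (le_max_left _ _) hM0.le)
    _ = _ := by ring

/-- This controls the sum over all pairs of words in the variance, with `x = n ^ (-k)`. For a fixed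
kernel, dropping injectivity makes the sum a product of power sums, each of order `M * x`. -/
theorem exists_sum_prod_abs_mul_pow_le_fin {τ : ℕ → ℝ}
    (hτ : ∀ q : ℕ, ∃ B : ℝ, 0 ≤ B ∧ ∀ M : ℕ, ∑ j : Fin M, |τ j| ^ q ≤ B * M) (N : ℕ) (B₀ : ℝ) :
    ∃ C : ℝ, 0 ≤ C ∧ ∀ (M : ℕ) (x : ℝ), 0 ≤ x → M * x ≤ B₀ →
      ∑ f : Fin N → Fin M, (∏ u, |τ (f u)|) * x ^ (Finset.univ.image f).card ≤ C := by
  choose B hB0 hB using hτ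
  refine ⟨∑ s ∈ Finset.range (N + 1), ∑ α ∈ canonicalAll s N, ∏ t, (B (deg α t) * |B₀|),
    Finset.sum_nonneg fun s _ => Finset.sum_nonneg fun α _ => Finset.prod_nonneg fun t _ =>
      mul_nonneg (hB0 _) (abs_nonneg _), fun M x hx hMx => ?_⟩
  rw [sum_eq_sum_canonicalAll]
  refine Finset.sum_le_sum fun s _ => Finset.sum_le_sum fun α hα => ?_
  have hα := mem_canonicalAll.1 hα
  calc ∑ φ ∈ injections s M, (∏ u, |τ ((φ ∘ α) u)|) * x ^ (Finset.univ.image (φ ∘ α)).card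
      = ∑ φ ∈ injections s M, ∏ t, (|τ (φ t)| ^ deg α t * x) := by
        refine Finset.sum_congr rfl fun φ hφ => ?_
        rw [← Finset.image_image, Finset.image_univ_of_surjective hα.1,
          Finset.card_image_of_injective _ (mem_injections.1 hφ), Finset.prod_mul_distrib]
        congr 1
        · rw [← Finset.prod_fiberwise (s := Finset.univ) (g := α)]
          refine Finset.prod_congr rfl fun t _ => ?_
          rw [deg, ← Finset.prod_const]
          refine Finset.prod_congr rfl fun u hu => ?_
          rw [Function.comp_apply, (Finset.mem_filter.1 hu).2]
        · simp
    _ ≤ ∑ φ : Fin s → Fin M, ∏ t, (|τ (φ t)| ^ deg α t * x) :=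
        Finset.sum_le_sum_of_subset_of_nonneg (Finset.subset_univ _) fun φ _ _ =>
          Finset.prod_nonneg fun t _ => by positivity
    _ = ∏ t, ∑ j : Fin M, |τ j| ^ deg α t * x :=
        (Fintype.prod_sum fun (t : Fin s) (j : Fin M) => |τ j| ^ deg α t * x).symm
    _ ≤ ∏ t, (B (deg α t) * |B₀|) := by
        refine Finset.prod_le_prod (fun t _ => Finset.sum_nonneg fun j _ => by positivity)
          fun t _ => ?_
        rw [← Finset.sum_mul]
        calc _ ≤ B (deg α t) * M * x := mul_le_mul_of_nonneg_right (hB _ M) hx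
          _ = B (deg α t) * (M * x) := by ring
          _ ≤ B (deg α t) * |B₀| :=
            mul_le_mul_of_nonneg_left (hMx.trans (le_abs_self _)) (hB0 _)

theorem exists_sum_prod_abs_mul_pow_le {τ : ℕ → ℝ}
    (hτ : ∀ q : ℕ, ∃ B : ℝ, 0 ≤ B ∧ ∀ M : ℕ, ∑ j : Fin M, |τ j| ^ q ≤ B * M)
    (V : Type*) [Fintype V] [DecidableEq V] (B₀ : ℝ) :
    ∃ C : ℝ, 0 ≤ C ∧ ∀ (M : ℕ) (x : ℝ), 0 ≤ x → M * x ≤ B₀ →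
      ∑ f : V → Fin M, (∏ u, |τ (f u)|) * x ^ (Finset.univ.image f).card ≤ C := by
  obtain ⟨C, hC0, hC⟩ := exists_sum_prod_abs_mul_pow_le_fin hτ (Fintype.card V) B₀
  refine ⟨C, hC0, fun M x hx hMx => (le_of_eq ?_).trans (hC M x hx hMx)⟩
  let e := Fintype.equivFin V
  rw [← (e.symm.arrowCongr (Equiv.refl (Fin M))).sum_comp]
  refine Finset.sum_congr rfl fun f _ => ?_
  have h1 : Finset.univ.image ((e.symm.arrowCongr (Equiv.refl (Fin M))) f) =
      Finset.univ.image f := by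
    ext j
    simp only [Finset.mem_image, Finset.mem_univ, true_and]
    exact e.exists_congr fun u => by simp
  rw [h1]
  congr 1
  exact e.prod_comp fun u => |τ (f u)|

/-! ### Word sums of pairs of cyclic words -/

section Pairs

variable {X : Type*} [DecidableEq X] {κ : ℕ → ℕ → ℂ}

theorem linked_rangeWord_sum {p : ℕ} (a a' : Fin p → X)
    (hmeet : ∃ u v, a u = a' v) :
    Linked (rangeWord (Sum.elim a a'))
      (rangeWord (Sum.elim a a') ∘ Equiv.sumCongr (finRotate p) (finRotate p)) := by
  obtain ⟨u₀, v₀, h₀⟩ := hmeet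
  intro f hf
  set γ := rangeWord (Sum.elim a a')
  have hγ : γ (Sum.inl u₀) = γ (Sum.inr v₀) := Subtype.ext h₀
  have hl (u) : f (γ (Sum.inl u)) ↔ f (γ (Sum.inl u₀)) :=
    iff_of_forall_iff_finRotate (f := fun u => f (γ (Sum.inl u))) (fun u => hf (Sum.inl u)) u u₀
  have hr (u) : f (γ (Sum.inr u)) ↔ f (γ (Sum.inr v₀)) :=
    iff_of_forall_iff_finRotate (f := fun u => f (γ (Sum.inr u))) (fun u => hf (Sum.inr u)) u v₀
  have hall (w) : f (γ w) ↔ f (γ (Sum.inl u₀)) := by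
    rcases w with u | u
    · exact hl u
    · rw [hr u, hγ]
  intro s s' hs
  obtain ⟨w, rfl⟩ := rangeWord_surjective (Sum.elim a a') s
  obtain ⟨w', rfl⟩ := rangeWord_surjective (Sum.elim a a') s'
  exact (hall w').2 ((hall w).1 hs)

variable {V : Type*} [Fintype V] [Fintype X]

/-- The vertex set is cut down to the range of `a`: unvisited vertices would destroy connectedness.
-/
theorem norm_wordSum_comp_perm_le [DecidableEq V] [Nonempty V] {K : ℝ} {N : ℕ} (hK : MomentBound κ N K)
    (hκ : IsStandardMoments κ) (hN : Fintype.card V ≤ N) (a : V → X) (σ : Equiv.Perm V)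
    (hl : Linked (rangeWord a) (rangeWord a ∘ σ)) {n : ℕ} (hn : 1 ≤ n) :
    ‖wordSum κ a (a ∘ σ) n‖ ≤ K ^ (2 * N) * (N + 1) ^ N *
      n ^ (Fintype.card V + 1 - (Finset.univ.image a).card) := by
  have : Nonempty {x // x ∈ Finset.univ.image a} := ⟨rangeWord a (Classical.arbitrary V)⟩
  have h := norm_wordSum_le hK hκ hN hl hn
  rw [Fintype.card_coe, ← wordSum_comp_left hκ Subtype.val_injective] at h
  exact h

theorem wordWeight_sum {J : Type*} [Fintype J] [DecidableEq J] {V' : Type*} [Fintype V']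
    (hκ : IsStandardMoments κ) (a b : V → X) (a' b' : V' → X)
    (hdisj : ∀ t, (∀ u, a u ≠ t ∧ b u ≠ t) ∨ (∀ u, a' u ≠ t ∧ b' u ≠ t)) (i : V → J) (i' : V' → J) :
    wordWeight κ (Sum.elim a a') (Sum.elim b b') (Sum.elim i i') =
      wordWeight κ a b i * wordWeight κ a' b' i' := by
  have hadd (c : V → X) (c' : V' → X) (t : X) (j : J) :
      edgeCount (Sum.elim c c') (Sum.elim i i') t j = edgeCount c i t j + edgeCount c' i' t j := by
    simp only [edgeCount, Finset.card_filter, Fintype.sum_sum_type]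
    rfl
  rw [wordWeight, wordWeight, wordWeight, ← Finset.prod_mul_distrib]
  refine Finset.prod_congr rfl fun e _ => ?_
  rw [hadd, hadd]
  rcases hdisj e.1 with h | h
  · have h1 : edgeCount a i e.1 e.2 = 0 := by
      rw [edgeCount, Finset.card_eq_zero, Finset.filter_eq_empty_iff]
      exact fun u _ hu => (h u).1 hu.1
    have h2 : edgeCount b i e.1 e.2 = 0 := by
      rw [edgeCount, Finset.card_eq_zero, Finset.filter_eq_empty_iff]
      exact fun u _ hu => (h u).2 hu.1
    rw [h1, h2, hκ.zero_zero, one_mul, zero_add, zero_add]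
  · have h1 : edgeCount a' i' e.1 e.2 = 0 := by
      rw [edgeCount, Finset.card_eq_zero, Finset.filter_eq_empty_iff]
      exact fun u _ hu => (h u).1 hu.1
    have h2 : edgeCount b' i' e.1 e.2 = 0 := by
      rw [edgeCount, Finset.card_eq_zero, Finset.filter_eq_empty_iff]
      exact fun u _ hu => (h u).2 hu.1
    rw [h1, h2, hκ.zero_zero, mul_one, add_zero, add_zero]

theorem wordSum_sum [DecidableEq V] {V' : Type*} [Fintype V'] [DecidableEq V']
    (hκ : IsStandardMoments κ) (a b : V → X) (a' b' : V' → X)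
    (hdisj : ∀ t, (∀ u, a u ≠ t ∧ b u ≠ t) ∨ (∀ u, a' u ≠ t ∧ b' u ≠ t)) (n : ℕ) :
    wordSum κ (Sum.elim a a') (Sum.elim b b') n = wordSum κ a b n * wordSum κ a' b' n := by
  rw [wordSum, wordSum, wordSum, Finset.sum_mul_sum,
    ← (Equiv.sumArrowEquivProdArrow V V' (Fin n)).symm.sum_comp, Fintype.sum_prod_type]
  exact Finset.sum_congr rfl fun i _ => Finset.sum_congr rfl fun i' _ =>
    wordWeight_sum hκ a b a' b' hdisj i i'

/-- The covariance of two words with `s` vertices in all is of order `n ^ (1 - s)`. -/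
theorem norm_wordSum_sub_le {K : ℝ} {p : ℕ} (hp : 1 ≤ p) (hκ : IsStandardMoments κ)
    (hK : MomentBound κ (p + p) K) (a a' : Fin p → X) {n : ℕ} (hn : 1 ≤ n) (k : ℕ) :
    ‖(wordSum κ (Sum.elim a a') (Sum.elim (a ∘ finRotate p) (a' ∘ finRotate p)) n /
        (n : ℂ) ^ (p + p)) ^ k -
      (wordSum κ a (a ∘ finRotate p) n / (n : ℂ) ^ p) ^ k *
        (wordSum κ a' (a' ∘ finRotate p) n / (n : ℂ) ^ p) ^ k‖ ≤
      2 * ((K ^ (2 * (p + p)) * ((p + p : ℕ) + 1) ^ (p + p)) ^ 2 * n) ^ k *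
        (((n : ℝ) ^ k)⁻¹) ^ (Finset.univ.image (Sum.elim a a')).card := by
  have hn0 : (0 : ℝ) < n := by exact_mod_cast hn
  have hn1 : (1 : ℝ) ≤ n := by exact_mod_cast hn
  have hK0 : 0 ≤ K := zero_le_one.trans hK.1
  set L : ℝ := K ^ (2 * (p + p)) * ((p + p : ℕ) + 1) ^ (p + p)
  have hL1 : 1 ≤ L := one_le_mul_of_one_le_of_one_le (one_le_pow₀ hK.1)
    (one_le_pow₀ (by linarith [Nat.cast_nonneg (α := ℝ) (p + p)]))
  set s := (Finset.univ.image (Sum.elim a a')).card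
  by_cases hmeet : ∃ u v, a u = a' v
  · have : Nonempty (Fin p) := ⟨⟨0, hp⟩⟩
    have hsum : Sum.elim (a ∘ finRotate p) (a' ∘ finRotate p) =
        Sum.elim a a' ∘ Equiv.sumCongr (finRotate p) (finRotate p) := by
      funext w
      cases w <;> rfl
    have hG := norm_wordSum_comp_perm_le hK hκ (by simp) (Sum.elim a a') _
      (linked_rangeWord_sum a a' hmeet) hn
    have hF := norm_wordSum_comp_perm_le hK hκ (by simp) a (finRotate p)
      (linked_finRotate (rangeWord_surjective a)) hn
    have hF' := norm_wordSum_comp_perm_le hK hκ (by simp) a' (finRotate p)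
      (linked_finRotate (rangeWord_surjective a')) hn
    rw [← hsum] at hG
    simp only [Fintype.card_sum, Fintype.card_fin] at hG hF hF'
    set s₁ := (Finset.univ.image a).card
    set s₂ := (Finset.univ.image a').card
    have hs₁ : s₁ ≤ p := Finset.card_image_le.trans (by simp)
    have hs₂ : s₂ ≤ p := Finset.card_image_le.trans (by simp)
    -- A common vertex is counted twice. This compensates for the two separate words having one
    -- column more, in all, than the connected pair.
    have hs : s + 1 ≤ s₁ + s₂ := by
      obtain ⟨u, v, huv⟩ := hmeet
      have h1 : Finset.univ.image (Sum.elim a a') = Finset.univ.image a ∪ Finset.univ.image a' := by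
        ext x
        simp
      have h2 : 0 < (Finset.univ.image a ∩ Finset.univ.image a').card :=
        Finset.card_pos.2 ⟨a u, Finset.mem_inter.2 ⟨by simp, by simp [huv]⟩⟩
      have h3 := Finset.card_union_add_card_inter (Finset.univ.image a) (Finset.univ.image a')
      rw [← h1] at h3
      change s + _ = s₁ + s₂ at h3
      omega
    have hpow : (n : ℝ) ^ (p + p + 1 - s) / (n : ℝ) ^ (p + p) = n / (n : ℝ) ^ s := by
      rw [div_eq_div_iff (by positivity) (by positivity), ← pow_add, ← pow_succ']
      congr 1
      omega
    -- `L ^ 2` instead of `L`, so that one bound serves both the pair and the product of the single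
    -- words.
    have hG' : ‖wordSum κ (Sum.elim a a') (Sum.elim (a ∘ finRotate p) (a' ∘ finRotate p)) n /
        (n : ℂ) ^ (p + p)‖ ≤ L ^ 2 * n / (n : ℝ) ^ s := by
      rw [norm_div, norm_pow, Complex.norm_natCast, mul_div_assoc, ← hpow, ← mul_div_assoc]
      refine div_le_div_of_nonneg_right (hG.trans ?_) (by positivity)
      exact mul_le_mul_of_nonneg_right (le_self_pow₀ hL1 (by norm_num)) (by positivity)
    have hFF : ‖wordSum κ a (a ∘ finRotate p) n / (n : ℂ) ^ p *
        (wordSum κ a' (a' ∘ finRotate p) n / (n : ℂ) ^ p)‖ ≤ L ^ 2 * n / (n : ℝ) ^ s := by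
      rw [div_mul_div_comm, ← pow_add, norm_div, norm_mul, norm_pow, Complex.norm_natCast,
        mul_div_assoc (L ^ 2), ← hpow, ← mul_div_assoc]
      refine div_le_div_of_nonneg_right ?_ (by positivity)
      calc _ ≤ L * n ^ (p + 1 - s₁) * (L * n ^ (p + 1 - s₂)) :=
            mul_le_mul hF hF' (norm_nonneg _) (by positivity)
        _ = L ^ 2 * n ^ ((p + 1 - s₁) + (p + 1 - s₂)) := by ring
        _ ≤ _ := mul_le_mul_of_nonneg_left (pow_le_pow_right₀ hn1 (by omega)) (by positivity)
    rw [← mul_pow]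
    refine (norm_sub_le _ _).trans ?_
    rw [norm_pow, norm_pow]
    have e1 := pow_le_pow_left₀ (norm_nonneg _) hG' k
    have e2 := pow_le_pow_left₀ (norm_nonneg _) hFF k
    have e3 : (L ^ 2 * n / (n : ℝ) ^ s) ^ k = (L ^ 2 * n) ^ k * (((n : ℝ) ^ k)⁻¹) ^ s := by
      rw [div_pow, div_eq_mul_inv, inv_pow, ← pow_mul, ← pow_mul, mul_comm s k]
    rw [e3] at e1 e2
    linarith
  -- Words without common vertex use independent entries: the word sum factorizes and the difference
  -- is exactly zero.
  · have hdisj (t : X) : (∀ u, a u ≠ t ∧ (a ∘ finRotate p) u ≠ t) ∨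
        (∀ u, a' u ≠ t ∧ (a' ∘ finRotate p) u ≠ t) := by
      by_cases ht : ∃ u, a u = t
      · obtain ⟨u, rfl⟩ := ht
        exact Or.inr fun v => ⟨fun h => hmeet ⟨_, _, h.symm⟩, fun h => hmeet ⟨_, _, h.symm⟩⟩
      · exact Or.inl fun u => ⟨fun h => ht ⟨_, h⟩, fun h => ht ⟨_, h⟩⟩
    rw [wordSum_sum hκ _ _ _ _ hdisj, ← mul_pow, div_mul_div_comm, ← pow_add, sub_self, norm_zero]
    positivity

end Pairs

/-! ### Expansion of the trace -/

/-- The arbitrary kernel `g` lets the induction absorb one factor of `A`; closing the path with `g x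
y = A y x` yields the trace. -/
theorem sum_pow_mul_eq {X R : Type*} [Fintype X] [DecidableEq X] [CommRing R] (A : Matrix X X R)
    (q : ℕ) : ∀ g : X → X → R, ∑ x, ∑ y, (A ^ q) x y * g x y =
      ∑ f : Fin (q + 1) → X, (∏ u : Fin q, A (f u.castSucc) (f u.succ)) * g (f 0) (f (Fin.last q)) := by
  induction q with
  | zero =>
    intro g
    rw [← (Equiv.funUnique (Fin 1) X).symm.sum_comp]
    refine Finset.sum_congr rfl fun x _ => ?_
    simp [Matrix.one_apply]
  | succ q ih =>
    intro g
    have key (F : X → X → X → R) : ∑ x, ∑ y, ∑ z, F x y z = ∑ z, ∑ y, ∑ x, F x y z := by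
      have h (y : X) : ∑ x, ∑ z, F x y z = ∑ z, ∑ x, F x y z := Finset.sum_comm
      rw [Finset.sum_comm, Finset.sum_congr rfl fun y _ => h y]
      exact Finset.sum_comm
    calc ∑ x, ∑ y, (A ^ (q + 1)) x y * g x y
        = ∑ z, ∑ y, (A ^ q) z y * ∑ x, A x z * g x y := by
          simp only [pow_succ', Matrix.mul_apply, Finset.sum_mul, Finset.mul_sum]
          rw [key]
          exact Finset.sum_congr rfl fun z _ => Finset.sum_congr rfl fun y _ =>
            Finset.sum_congr rfl fun x _ => by ring
      _ = _ := by
          refine (ih fun z y => ∑ x, A x z * g x y).trans (Eq.trans ?_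
            ((Fin.consEquiv fun _ => X).sum_comp _))
          rw [Fintype.sum_prod_type_right]
          refine Finset.sum_congr rfl fun f _ => ?_
          rw [Finset.mul_sum]
          refine Finset.sum_congr rfl fun x _ => ?_
          rw [Fin.prod_univ_succ]
          change _ = A x (f 0) * (∏ u : Fin q, A (f u.castSucc) (f u.succ)) * g x (f (Fin.last q))
          ring

theorem trace_pow_eq_sum {X R : Type*} [Fintype X] [DecidableEq X] [CommRing R]
    (A : Matrix X X R) {p : ℕ} (hp : 1 ≤ p) :
    Matrix.trace (A ^ p) = ∑ f : Fin p → X, ∏ u, A (f u) (f (finRotate p u)) := by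
  obtain ⟨q, rfl⟩ := Nat.exists_eq_add_of_le' hp
  rw [pow_succ, Matrix.trace]
  simp only [Matrix.diag_apply, Matrix.mul_apply]
  rw [sum_pow_mul_eq A q fun x y => A y x]
  refine Finset.sum_congr rfl fun f _ => ?_
  rw [Fin.prod_univ_castSucc]
  simp [finRotate_apply, Fin.coeSucc_eq_succ]

theorem trace_mul_pow_comm {X Y R : Type*} [Fintype X] [DecidableEq X] [Fintype Y] [DecidableEq Y]
    [CommRing R] (A : Matrix X Y R) (B : Matrix Y X R) {p : ℕ} (hp : 1 ≤ p) :
    Matrix.trace ((A * B) ^ p) = Matrix.trace ((B * A) ^ p) := by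
  obtain ⟨q, rfl⟩ := Nat.exists_eq_add_of_le' hp
  have h (q : ℕ) : (A * B) ^ (q + 1) = A * ((B * A) ^ q * B) := by
    induction q with
    | zero => simp
    | succ q ih => rw [pow_succ', ih, pow_succ' (B * A)]; simp only [Matrix.mul_assoc]
  rw [h, Matrix.trace_mul_comm, Matrix.mul_assoc, ← pow_succ]

/-- The product of the normalized scalar products along the arrows of a word. -/
noncomputable def wordProd {V : Type*} [Fintype V] {n k m : ℕ} (x : Fin m → Fin k → Fin n → ℂ)
    (a b : V → Fin m) : ℂ :=
  ∏ l, ∏ u, (∑ i, star (x (a u) l i) * x (b u) l i) / n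

theorem sum_star_tensorColumn_mul {n k m : ℕ} (x : Fin m → Fin k → Fin n → ℂ) (α β : Fin m) :
    ∑ I, star (tensorColumn x α I) * tensorColumn x β I =
      ∏ l, (∑ i, star (x α l i) * x β l i) / n := by
  have hn : (Real.sqrt n : ℂ) * Real.sqrt n = n := by
    rw [← Complex.ofReal_mul, Real.mul_self_sqrt (Nat.cast_nonneg n)]
    simp
  simp only [tensorColumn, Finset.sum_div, star_prod]
  rw [Fintype.prod_sum]
  refine Finset.sum_congr rfl fun I _ => ?_
  rw [← Finset.prod_mul_distrib]
  refine Finset.prod_congr rfl fun l _ => ?_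
  rw [star_div₀, ← hn, div_mul_div_comm]
  congr 2
  exact Complex.conj_ofReal _

theorem trace_tensorCovMatrix_pow {n k m : ℕ} (τ : ℕ → ℝ) (x : Fin m → Fin k → Fin n → ℂ) {p : ℕ}
    (hp : 1 ≤ p) : Matrix.trace (tensorCovMatrix τ x ^ p) =
      ∑ a : Fin p → Fin m, (∏ u, (τ (a u) : ℂ)) * wordProd x a (a ∘ finRotate p) := by
  let A : Matrix (Fin k → Fin n) (Fin m) ℂ := Matrix.of fun I α => tensorColumn x α I
  let B : Matrix (Fin m) (Fin k → Fin n) ℂ := Matrix.of fun α I => τ α * star (tensorColumn x α I)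
  have hM : tensorCovMatrix τ x = A * B := by
    ext I J
    simp only [tensorCovMatrix, Matrix.sum_apply, Matrix.smul_apply, Matrix.vecMulVec_apply,
      Matrix.mul_apply, A, B, Matrix.of_apply, smul_eq_mul, Pi.star_apply]
    exact Finset.sum_congr rfl fun α _ => by ring
  have hBA (α β : Fin m) : (B * A) α β =
      τ α * ∏ l, (∑ i, star (x α l i) * x β l i) / n := by
    rw [← sum_star_tensorColumn_mul, Finset.mul_sum, Matrix.mul_apply]
    exact Finset.sum_congr rfl fun I _ => mul_assoc _ _ _
  -- Cyclicity passes to the `m × m` matrix `B * A`, whose entries factorize over the tensor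
  -- factors.
  rw [hM, trace_mul_pow_comm A B hp, trace_pow_eq_sum _ hp]
  refine Finset.sum_congr rfl fun a _ => ?_
  rw [Finset.prod_congr rfl fun u _ => hBA _ _, Finset.prod_mul_distrib, wordProd,
    Finset.prod_comm]
  rfl

/-- Collecting the powers of each entry turns every summand into a product over independent
variables. -/
theorem wordProd_eq_sum {V : Type*} [Fintype V] [DecidableEq V] {n k m : ℕ}
    (x : Fin m → Fin k → Fin n → ℂ) (a b : V → Fin m) :
    wordProd x a b = (∑ I : Fin k → V → Fin n, ∏ q : Fin m × Fin k × Fin n,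
      star (x q.1 q.2.1 q.2.2) ^ edgeCount a (I q.2.1) q.1 q.2.2 *
        x q.1 q.2.1 q.2.2 ^ edgeCount b (I q.2.1) q.1 q.2.2) /
      ((n : ℂ) ^ Fintype.card V) ^ k := by
  have hfib (g : Fin m → Fin n → ℂ) (c : V → Fin m) (i : V → Fin n) :
      ∏ u, g (c u) (i u) = ∏ t, ∏ j, g t j ^ edgeCount c i t j := by
    rw [← Fintype.prod_prod_type' fun t j => g t j ^ edgeCount c i t j,
      ← Finset.prod_fiberwise (s := Finset.univ) (g := fun u => (c u, i u))]
    refine Finset.prod_congr rfl fun e _ => ?_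
    rw [edgeCount, ← Finset.prod_const]
    refine Finset.prod_congr (by ext u; simp [Prod.ext_iff]) fun u hu => ?_
    obtain ⟨h1, h2⟩ := (Finset.mem_filter.1 hu).2
    rw [h1, h2]
  have h1 (l : Fin k) : ∏ u, (∑ i, star (x (a u) l i) * x (b u) l i) / (n : ℂ) =
      (∑ i : V → Fin n, ∏ t, ∏ j, star (x t l j) ^ edgeCount a i t j *
        x t l j ^ edgeCount b i t j) / (n : ℂ) ^ Fintype.card V := by
    rw [Finset.prod_div_distrib, Finset.prod_const, Finset.card_univ, Fintype.prod_sum]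
    congr 1
    refine Finset.sum_congr rfl fun i _ => ?_
    rw [Finset.prod_mul_distrib, hfib (fun t j => star (x t l j)), hfib (fun t j => x t l j)]
    simp only [← Finset.prod_mul_distrib]
  rw [wordProd, Finset.prod_congr rfl fun l _ => h1 l, Finset.prod_div_distrib,
    Finset.prod_const, Finset.card_univ, Fintype.card_fin, Fintype.prod_sum]
  congr 1
  refine Finset.sum_congr rfl fun I _ => ?_
  rw [Fintype.prod_prod_type, Finset.prod_comm]
  exact Finset.prod_congr rfl fun t _ => by rw [Fintype.prod_prod_type]

theorem wordProd_sum {V V' : Type*} [Fintype V] [Fintype V'] {n k m : ℕ}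
    (x : Fin m → Fin k → Fin n → ℂ) (a b : V → Fin m) (a' b' : V' → Fin m) :
    wordProd x (Sum.elim a a') (Sum.elim b b') = wordProd x a b * wordProd x a' b' := by
  simp only [wordProd, Fintype.prod_sum_type, Sum.elim_inl, Sum.elim_inr, Finset.prod_mul_distrib]

/-! ### Moments -/

/-- The mixed moments of a complex distribution. -/
noncomputable def mixedMoment (μ : Measure ℂ) (x y : ℕ) : ℂ := ∫ z, star z ^ x * z ^ y ∂μ

theorem isStandardMoments_mixedMoment {μ : Measure ℂ} [IsProbabilityMeasure μ]
    (hmean : ∫ z, z ∂μ = 0) (hvar : ∫ z, ‖z‖ ^ 2 ∂μ = 1) :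
    IsStandardMoments (mixedMoment μ) where
  zero_zero := by simp [mixedMoment]
  one_zero := by
    have : ∫ z, (starRingEnd ℂ) z ∂μ = (starRingEnd ℂ) (∫ z, z ∂μ) := integral_conj
    simp only [mixedMoment, pow_one, pow_zero, mul_one]
    rw [hmean, map_zero] at this
    exact this
  zero_one := by simpa [mixedMoment] using hmean
  one_one := by
    have h (z : ℂ) : star z ^ 1 * z ^ 1 = ((‖z‖ ^ 2 : ℝ) : ℂ) := by
      rw [pow_one, pow_one]
      exact (Complex.conj_mul' z).trans (by push_cast; rfl)
    simp only [mixedMoment, h]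
    have h2 : ∫ z, ((‖z‖ ^ 2 : ℝ) : ℂ) ∂μ = ((∫ z, ‖z‖ ^ 2 ∂μ : ℝ) : ℂ) := integral_ofReal
    rw [h2, hvar, Complex.ofReal_one]

theorem mixedMoment_two_two (μ : Measure ℂ) :
    mixedMoment μ 2 2 = ((∫ z, ‖z‖ ^ 4 ∂μ : ℝ) : ℂ) := by
  have h (z : ℂ) : star z ^ 2 * z ^ 2 = ((‖z‖ ^ 4 : ℝ) : ℂ) := by
    rw [← mul_pow]
    refine (congrArg (· ^ 2) (Complex.conj_mul' z)).trans ?_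
    push_cast
    ring
  simp only [mixedMoment, h]
  exact integral_ofReal

/-- A random variable with finite moments of all orders. -/
def HasMoments {Ω : Type*} [MeasurableSpace Ω] (P : Measure Ω) (f : Ω → ℂ) : Prop :=
  ∀ q : ℕ, MemLp f q P

section HasMoments

variable {Ω : Type*} [MeasurableSpace Ω] {P : Measure Ω}

theorem HasMoments.const [IsProbabilityMeasure P] (c : ℂ) : HasMoments P fun _ => c :=
  fun _ => memLp_const c

theorem HasMoments.mul {f g : Ω → ℂ} (hf : HasMoments P f) (hg : HasMoments P g) :
    HasMoments P fun ω => f ω * g ω := by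
  intro q
  have : ENNReal.HolderTriple ((2 * q : ℕ) : ENNReal) ((2 * q : ℕ) : ENNReal) (q : ENNReal) := by
    refine ⟨?_⟩
    rw [← two_mul, Nat.cast_mul, ENNReal.mul_inv (by simp) (by simp), ← mul_assoc]
    simp [ENNReal.mul_inv_cancel]
  exact (hg (2 * q)).mul' (hf (2 * q))

theorem HasMoments.star {f : Ω → ℂ} (hf : HasMoments P f) : HasMoments P fun ω => star (f ω) :=
  fun q => (hf q).star

theorem HasMoments.sum {ι : Type*} (s : Finset ι) {f : ι → Ω → ℂ}
    (hf : ∀ i ∈ s, HasMoments P (f i)) : HasMoments P fun ω => ∑ i ∈ s, f i ω :=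
  fun q => memLp_finsetSum s fun i hi => hf i hi q

theorem HasMoments.prod [IsProbabilityMeasure P] {ι : Type*} (s : Finset ι) {f : ι → Ω → ℂ}
    (hf : ∀ i ∈ s, HasMoments P (f i)) : HasMoments P fun ω => ∏ i ∈ s, f i ω := by
  classical
  induction s using Finset.induction_on with
  | empty => simpa using HasMoments.const 1
  | insert i s hi ih =>
    simp only [Finset.prod_insert hi]
    exact (hf i (Finset.mem_insert_self i s)).mul
      (ih fun j hj => hf j (Finset.mem_insert_of_mem hj))

theorem HasMoments.integrable {f : Ω → ℂ} (hf : HasMoments P f) : Integrable f P :=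
  memLp_one_iff_integrable.1 (by simpa using hf 1)

theorem HasMoments.wordProd [IsProbabilityMeasure P] {V : Type*} [Fintype V] {n k m : ℕ}
    {ξ : Fin m → Fin k → Fin n → Ω → ℂ} (hξ : ∀ α l i, HasMoments P (ξ α l i))
    (a b : V → Fin m) : HasMoments P fun ω => wordProd (fun α l i => ξ α l i ω) a b := by
  refine HasMoments.prod _ fun l _ => HasMoments.prod _ fun u _ => ?_
  simp only [div_eq_mul_inv]
  exact (HasMoments.sum _ fun i _ => (hξ _ _ _).star.mul (hξ _ _ _)).mul (HasMoments.const _)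

theorem HasMoments.trace [IsProbabilityMeasure P] {n k m : ℕ}
    {ξ : Fin m → Fin k → Fin n → Ω → ℂ} (hξ : ∀ α l i, HasMoments P (ξ α l i)) (τ : ℕ → ℝ)
    {p : ℕ} (hp : 1 ≤ p) :
    HasMoments P fun ω => Matrix.trace (tensorCovMatrix τ (fun α l i => ξ α l i ω) ^ p) := by
  simp only [trace_tensorCovMatrix_pow τ _ hp]
  exact HasMoments.sum _ fun a _ => (HasMoments.const _).mul (HasMoments.wordProd hξ _ _)

theorem hasMoments_of_hasLaw {μ : Measure ℂ} {f : Ω → ℂ} (hf : HasLaw f μ P)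
    (hmom : ∀ q : ℕ, Integrable (fun z : ℂ => ‖z‖ ^ q) μ) : HasMoments P f := by
  intro q
  have h : MemLp (id : ℂ → ℂ) q μ := by
    rcases Nat.eq_zero_or_pos q with rfl | hq
    · simpa using measurable_id.aestronglyMeasurable
    · rw [← integrable_norm_rpow_iff measurable_id.aestronglyMeasurable
        (by exact_mod_cast hq.ne') (ENNReal.natCast_ne_top q)]
      simpa using hmom q
  rw [← hf.map_eq] at h
  exact h.comp_of_map hf.aemeasurable

/-- Independence turns each monomial into a product of mixed moments; the `k` tensor factors give
identical sums, hence the power. -/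
theorem integral_wordProd {μ : Measure ℂ} {n k m : ℕ} {ξ : Fin m → Fin k → Fin n → Ω → ℂ}
    [IsProbabilityMeasure P] (hmom : ∀ q : ℕ, Integrable (fun z : ℂ => ‖z‖ ^ q) μ)
    (hlaw : ∀ α l i, HasLaw (ξ α l i) μ P)
    (hindep : iIndepFun (fun j : Fin m × Fin k × Fin n => ξ j.1 j.2.1 j.2.2) P)
    {V : Type*} [Fintype V] [DecidableEq V] (a b : V → Fin m) :
    ∫ ω, wordProd (fun α l i => ξ α l i ω) a b ∂P =
      (wordSum (mixedMoment μ) a b n / (n : ℂ) ^ Fintype.card V) ^ k := by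
  have hξ (α l i) : HasMoments P (ξ α l i) := hasMoments_of_hasLaw (hlaw α l i) hmom
  have hpow {f : Ω → ℂ} (hf : HasMoments P f) (q : ℕ) : HasMoments P fun ω => f ω ^ q := by
    simpa using HasMoments.prod (Finset.range q) (f := fun _ => f) fun _ _ => hf
  simp only [wordProd_eq_sum]
  rw [integral_div, integral_finsetSum _ fun I _ => (HasMoments.prod _ fun q _ =>
    (hpow (hξ _ _ _).star _).mul (hpow (hξ _ _ _) _)).integrable, div_pow]
  congr 1
  have hprod (I : Fin k → V → Fin n) : ∫ ω, ∏ q : Fin m × Fin k × Fin n,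
      star (ξ q.1 q.2.1 q.2.2 ω) ^ edgeCount a (I q.2.1) q.1 q.2.2 *
        ξ q.1 q.2.1 q.2.2 ω ^ edgeCount b (I q.2.1) q.1 q.2.2 ∂P =
      ∏ l, wordWeight (mixedMoment μ) a b (I l) := by
    have hmeas (x y : ℕ) : Measurable fun z : ℂ => star z ^ x * z ^ y := by fun_prop
    rw [hindep.integral_fun_prod_comp (fun q => (hlaw _ _ _).aemeasurable)
      (f := fun q z => star z ^ edgeCount a (I q.2.1) q.1 q.2.2 *
        z ^ edgeCount b (I q.2.1) q.1 q.2.2) fun q => (hmeas _ _).aestronglyMeasurable]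
    have h2 (q : Fin m × Fin k × Fin n) : ∫ ω, star (ξ q.1 q.2.1 q.2.2 ω) ^
        edgeCount a (I q.2.1) q.1 q.2.2 *
        ξ q.1 q.2.1 q.2.2 ω ^ edgeCount b (I q.2.1) q.1 q.2.2 ∂P =
        mixedMoment μ (edgeCount a (I q.2.1) q.1 q.2.2) (edgeCount b (I q.2.1) q.1 q.2.2) :=
      (hlaw _ _ _).integral_comp (hmeas _ _).aestronglyMeasurable
    rw [Finset.prod_congr rfl fun q _ => h2 q, Fintype.prod_prod_type]
    simp only [wordWeight, Fintype.prod_prod_type]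
    exact Finset.prod_comm
  rw [Finset.sum_congr rfl fun I _ => hprod I, wordSum]
  have := Fintype.prod_sum fun (_ : Fin k) (i : V → Fin n) => wordWeight (mixedMoment μ) a b i
  rw [← this, Finset.prod_const, Finset.card_univ, Fintype.card_fin]

end HasMoments

/-! ### Expectation and variance of the trace -/

theorem integral_trace {Ω : Type*} [MeasurableSpace Ω] {P : Measure Ω} [IsProbabilityMeasure P]
    {μ : Measure ℂ} {n k m : ℕ} {ξ : Fin m → Fin k → Fin n → Ω → ℂ}
    (hmom : ∀ q : ℕ, Integrable (fun z : ℂ => ‖z‖ ^ q) μ)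
    (hlaw : ∀ α l i, HasLaw (ξ α l i) μ P)
    (hindep : iIndepFun (fun j : Fin m × Fin k × Fin n => ξ j.1 j.2.1 j.2.2) P)
    (τ : ℕ → ℝ) {p : ℕ} (hp : 1 ≤ p) :
    ∫ ω, Matrix.trace (tensorCovMatrix τ (fun α l i => ξ α l i ω) ^ p) ∂P =
      ∑ a : Fin p → Fin m, (∏ u, (τ (a u) : ℂ)) *
        (wordSum (mixedMoment μ) a (a ∘ finRotate p) n / (n : ℂ) ^ p) ^ k := by
  have hξ (α l i) : HasMoments P (ξ α l i) := hasMoments_of_hasLaw (hlaw α l i) hmom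
  simp only [trace_tensorCovMatrix_pow τ _ hp]
  rw [integral_finsetSum _ fun a _ =>
    ((HasMoments.const _).mul (HasMoments.wordProd hξ _ _)).integrable]
  refine Finset.sum_congr rfl fun a _ => ?_
  rw [integral_const_mul, integral_wordProd hmom hlaw hindep, Fintype.card_fin]

theorem integral_trace_sq {Ω : Type*} [MeasurableSpace Ω] {P : Measure Ω} [IsProbabilityMeasure P]
    {μ : Measure ℂ} {n k m : ℕ} {ξ : Fin m → Fin k → Fin n → Ω → ℂ}
    (hmom : ∀ q : ℕ, Integrable (fun z : ℂ => ‖z‖ ^ q) μ)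
    (hlaw : ∀ α l i, HasLaw (ξ α l i) μ P)
    (hindep : iIndepFun (fun j : Fin m × Fin k × Fin n => ξ j.1 j.2.1 j.2.2) P)
    (τ : ℕ → ℝ) {p : ℕ} (hp : 1 ≤ p) :
    ∫ ω, Matrix.trace (tensorCovMatrix τ (fun α l i => ξ α l i ω) ^ p) ^ 2 ∂P =
      ∑ a : Fin p → Fin m, ∑ a' : Fin p → Fin m,
        ((∏ u, (τ (a u) : ℂ)) * ∏ u, (τ (a' u) : ℂ)) *
        (wordSum (mixedMoment μ) (Sum.elim a a')
          (Sum.elim (a ∘ finRotate p) (a' ∘ finRotate p)) n / (n : ℂ) ^ (p + p)) ^ k := by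
  have hξ (α l i) : HasMoments P (ξ α l i) := hasMoments_of_hasLaw (hlaw α l i) hmom
  simp only [trace_tensorCovMatrix_pow τ _ hp, sq, Finset.sum_mul_sum]
  have hpt (x : Fin m → Fin k → Fin n → ℂ) (a a' : Fin p → Fin m) :
      (∏ u, (τ (a u) : ℂ)) * wordProd x a (a ∘ finRotate p) *
        ((∏ u, (τ (a' u) : ℂ)) * wordProd x a' (a' ∘ finRotate p)) =
      ((∏ u, (τ (a u) : ℂ)) * ∏ u, (τ (a' u) : ℂ)) *
        wordProd x (Sum.elim a a') (Sum.elim (a ∘ finRotate p) (a' ∘ finRotate p)) := by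
    rw [wordProd_sum]
    ring
  simp only [hpt]
  have hint (a a' : Fin p → Fin m) := (HasMoments.const (P := P)
    ((∏ u, (τ (a u) : ℂ)) * ∏ u, (τ (a' u) : ℂ))).mul (HasMoments.wordProd hξ (Sum.elim a a')
      (Sum.elim (a ∘ finRotate p) (a' ∘ finRotate p)))
  rw [integral_finsetSum _ fun a _ => (HasMoments.sum _ fun a' _ => hint a a').integrable]
  refine Finset.sum_congr rfl fun a _ => ?_
  rw [integral_finsetSum _ fun a' _ => (hint a a').integrable]
  refine Finset.sum_congr rfl fun a' _ => ?_
  rw [integral_const_mul, integral_wordProd hmom hlaw hindep, Fintype.card_sum, Fintype.card_fin]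

theorem norm_integral_trace_sq_sub_le {Ω : Type*} [MeasurableSpace Ω] {P : Measure Ω}
    [IsProbabilityMeasure P]
    {μ : Measure ℂ} {n k m : ℕ} {ξ : Fin m → Fin k → Fin n → Ω → ℂ}
    (hmom : ∀ q : ℕ, Integrable (fun z : ℂ => ‖z‖ ^ q) μ)
    (hlaw : ∀ α l i, HasLaw (ξ α l i) μ P)
    (hindep : iIndepFun (fun j : Fin m × Fin k × Fin n => ξ j.1 j.2.1 j.2.2) P)
    (τ : ℕ → ℝ) {p : ℕ} (hp : 1 ≤ p) (hκ : IsStandardMoments (mixedMoment μ)) {K : ℝ}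
    (hK : MomentBound (mixedMoment μ) (p + p) K) (hn : 1 ≤ n) :
    ‖∫ ω, Matrix.trace (tensorCovMatrix τ (fun α l i => ξ α l i ω) ^ p) ^ 2 ∂P -
      (∫ ω, Matrix.trace (tensorCovMatrix τ (fun α l i => ξ α l i ω) ^ p) ∂P) ^ 2‖ ≤
      2 * ((K ^ (2 * (p + p)) * ((p + p : ℕ) + 1) ^ (p + p)) ^ 2 * n) ^ k *
        ∑ f : Fin p ⊕ Fin p → Fin m, (∏ u, |τ (f u)|) *
          (((n : ℝ) ^ k)⁻¹) ^ (Finset.univ.image f).card := by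
  rw [integral_trace_sq hmom hlaw hindep τ hp, integral_trace hmom hlaw hindep τ hp, sq,
    Finset.sum_mul_sum, ← Finset.sum_sub_distrib,
    ← (Equiv.sumArrowEquivProdArrow (Fin p) (Fin p) (Fin m)).symm.sum_comp, Fintype.sum_prod_type,
    Finset.mul_sum]
  refine norm_sum_le_of_le _ fun a _ => ?_
  rw [← Finset.sum_sub_distrib, Finset.mul_sum]
  refine norm_sum_le_of_le _ fun a' _ => ?_
  have h := norm_wordSum_sub_le hp hκ hK a a' hn k
  have hcoef : ‖(∏ u, (τ (a u) : ℂ)) * ∏ u, (τ (a' u) : ℂ)‖ =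
      ∏ u, |τ ((Sum.elim a a' : Fin p ⊕ Fin p → Fin m) u)| := by
    rw [norm_mul, norm_prod, norm_prod, Fintype.prod_sum_type]
    simp
  rw [mul_mul_mul_comm, ← mul_sub, norm_mul, hcoef]
  refine (mul_le_mul_of_nonneg_left h (Finset.prod_nonneg fun u _ => abs_nonneg _)).trans
    (le_of_eq ?_)
  change _ = _ * ((∏ u, |τ ((Sum.elim a a' : Fin p ⊕ Fin p → Fin m) u)|) *
    (((n : ℝ) ^ k)⁻¹) ^ (Finset.univ.image (Sum.elim a a')).card)
  ring

theorem memLp_traceMoment {Ω : Type*} [MeasurableSpace Ω] {P : Measure Ω} [IsProbabilityMeasure P]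
    {n k m : ℕ} {ξ : Fin m → Fin k → Fin n → Ω → ℂ} (hξ : ∀ α l i, HasMoments P (ξ α l i))
    (τ : ℕ → ℝ) {p : ℕ} (hp : 1 ≤ p) :
    MemLp (fun ω => traceMoment τ p (fun α l i => ξ α l i ω)) 2 P := by
  have h := (HasMoments.trace hξ τ hp 2).re
  simp only [traceMoment, div_eq_mul_inv]
  exact h.mul_const _

theorem variance_traceMoment {Ω : Type*} [MeasurableSpace Ω] {P : Measure Ω}
    [IsProbabilityMeasure P] {n k m : ℕ} {ξ : Fin m → Fin k → Fin n → Ω → ℂ}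
    (hξ : ∀ α l i, HasMoments P (ξ α l i)) (τ : ℕ → ℝ) {p : ℕ} (hp : 1 ≤ p) :
    (Var[fun ω => traceMoment τ p (fun α l i => ξ α l i ω); P] : ℂ) =
      (∫ ω, Matrix.trace (tensorCovMatrix τ (fun α l i => ξ α l i ω) ^ p) ^ 2 ∂P -
      (∫ ω, Matrix.trace (tensorCovMatrix τ (fun α l i => ξ α l i ω) ^ p) ∂P) ^ 2) /
        ((n : ℂ) ^ k) ^ 2 := by
  rw [variance_eq_sub (memLp_traceMoment hξ τ hp)]
  have h1 : ((∫ ω, traceMoment τ p (fun α l i => ξ α l i ω) ∂P : ℝ) : ℂ) =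
      (∫ ω, Matrix.trace (tensorCovMatrix τ (fun α l i => ξ α l i ω) ^ p) ∂P) / (n : ℂ) ^ k := by
    rw [← integral_div]
    simp only [← coe_traceMoment]
    exact integral_ofReal.symm
  have h2 : ((∫ ω, ((fun ω => traceMoment τ p (fun α l i => ξ α l i ω)) ^ 2) ω ∂P : ℝ) : ℂ) =
      (∫ ω, Matrix.trace (tensorCovMatrix τ (fun α l i => ξ α l i ω) ^ p) ^ 2 ∂P) /
        ((n : ℂ) ^ k) ^ 2 := by
    rw [← integral_div]
    simp only [← div_pow, ← coe_traceMoment, Pi.pow_apply, ← Complex.ofReal_pow]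
    exact integral_ofReal.symm
  rw [Complex.ofReal_sub, Complex.ofReal_pow, h1, h2]
  ring

theorem coe_integral_traceMoment {Ω : Type*} [MeasurableSpace Ω] {P : Measure Ω}
    [IsProbabilityMeasure P] {μ : Measure ℂ} {n k m : ℕ} {ξ : Fin m → Fin k → Fin n → Ω → ℂ}
    (hmom : ∀ q : ℕ, Integrable (fun z : ℂ => ‖z‖ ^ q) μ)
    (hlaw : ∀ α l i, HasLaw (ξ α l i) μ P)
    (hindep : iIndepFun (fun j : Fin m × Fin k × Fin n => ξ j.1 j.2.1 j.2.2) P)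
    (τ : ℕ → ℝ) {p : ℕ} (hp : 1 ≤ p) (hκ : IsStandardMoments (mixedMoment μ)) (hn : 1 ≤ n) :
    ((∫ ω, traceMoment τ p (fun α l i => ξ α l i ω) ∂P : ℝ) : ℂ) =
      ∑ s ∈ Finset.range (p + 1), ∑ α ∈ canonicalAll s p,
        (((∑ φ ∈ injections s m, ∏ t, τ (φ t) ^ deg α t) / ((n : ℝ) ^ k) ^ s : ℝ) : ℂ) *
          (wordSum (mixedMoment μ) α (α ∘ finRotate p) n / n ^ (p + 1 - s)) ^ k := by
  have hn0 : (n : ℂ) ≠ 0 := Nat.cast_ne_zero.2 (by omega)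
  have h1 : ((∫ ω, traceMoment τ p (fun α l i => ξ α l i ω) ∂P : ℝ) : ℂ) =
      (∫ ω, Matrix.trace (tensorCovMatrix τ (fun α l i => ξ α l i ω) ^ p) ∂P) / (n : ℂ) ^ k := by
    rw [← integral_div]
    simp only [← coe_traceMoment]
    exact integral_ofReal.symm
  rw [h1, integral_trace hmom hlaw hindep τ hp, sum_eq_sum_canonicalAll, Finset.sum_div]
  refine Finset.sum_congr rfl fun s _ => ?_
  rw [Finset.sum_div]
  refine Finset.sum_congr rfl fun α hα => ?_
  have hα := mem_canonicalAll.1 hα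
  rw [Complex.ofReal_div, Complex.ofReal_sum, Finset.sum_div, Finset.sum_div, Finset.sum_mul]
  refine Finset.sum_congr rfl fun φ hφ => ?_
  have hτ : ∏ u, (τ ((φ ∘ α) u) : ℂ) = ((∏ t, τ (φ t) ^ deg α t : ℝ) : ℂ) := by
    rw [← Finset.prod_fiberwise (s := Finset.univ) (g := α)]
    push_cast
    refine Finset.prod_congr rfl fun t _ => ?_
    rw [deg, ← Finset.prod_const]
    refine Finset.prod_congr rfl fun u hu => ?_
    rw [Function.comp_apply, (Finset.mem_filter.1 hu).2]
  have hw : wordSum (mixedMoment μ) (φ ∘ α) ((φ ∘ α) ∘ finRotate p) n =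
      wordSum (mixedMoment μ) α (α ∘ finRotate p) n :=
    wordSum_comp_left hκ (mem_injections.1 hφ) _ _ _
  have hs := hα.le
  -- The normalization splits: `n ^ (p + 1 - s)` for the columns, `n ^ s` for the vertices, matching
  -- `m ^ s`.
  have hnp : (n : ℂ) ^ p * n = n ^ (p + 1 - s) * n ^ s := by
    rw [← pow_succ, ← pow_add]
    congr 1
    omega
  rw [hτ, hw]
  push_cast
  rw [mul_div_assoc, div_mul_eq_mul_div, mul_div_assoc]
  congr 1
  rw [← pow_mul, mul_comm k s, pow_mul, ← div_pow, ← div_pow, div_div, div_div, hnp]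

/-- The sum of the squared deviations has finite expectation, so it is almost surely finite and its
terms tend to zero. -/
theorem ae_tendsto_of_summable_variance {Ω : Type*} [MeasurableSpace Ω] {P : Measure Ω}
    [IsProbabilityMeasure P] {X : ℕ → Ω → ℝ} {a : ℝ} (hX : ∀ n, MemLp (X n) 2 P)
    (hE : Tendsto (fun n => ∫ ω, X n ω ∂P) atTop (𝓝 a))
    (hs : Summable fun n => Var[X n; P]) :
    ∀ᵐ ω ∂P, Tendsto (fun n => X n ω) atTop (𝓝 a) := by
  have hmeas (n : ℕ) : AEMeasurable (fun ω => ‖X n ω - ∫ ω, X n ω ∂P‖ₑ ^ 2) P :=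
    (((hX n).aestronglyMeasurable.aemeasurable.sub_const _).enorm).pow_const 2
  have hfin : ∫⁻ ω, ∑' n, ‖X n ω - ∫ ω, X n ω ∂P‖ₑ ^ 2 ∂P ≠ ⊤ := by
    rw [lintegral_tsum hmeas]
    have h (n : ℕ) : ∫⁻ ω, ‖X n ω - ∫ ω, X n ω ∂P‖ₑ ^ 2 ∂P = ENNReal.ofReal Var[X n; P] :=
      (hX n).ofReal_variance_eq.symm
    simp only [h]
    exact hs.tsum_ofReal_ne_top
  filter_upwards [ae_lt_top' (AEMeasurable.tsum hmeas) hfin] with ω hω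
  have h1 := ENNReal.tendsto_cofinite_zero_of_tsum_ne_top hω.ne
  rw [Nat.cofinite_eq_atTop] at h1
  have h2 := (ENNReal.tendsto_toReal ENNReal.zero_ne_top).comp h1
  have h3 := (Real.continuous_sqrt.tendsto _).comp h2
  have h4 : Tendsto (fun n => X n ω - ∫ ω, X n ω ∂P) atTop (𝓝 0) := by
    rw [tendsto_zero_iff_norm_tendsto_zero]
    simpa [Function.comp_def, Real.sqrt_sq_eq_abs] using h3
  simpa using h4.add hE

/-! ### Limits in the regime of the theorem -/

section Limits

variable {k m : ℕ → ℕ} {c d : ℝ}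

theorem tendsto_natCast_size (hc : 0 < c) (hd : 0 < d)
    (hk : Tendsto (fun n : ℕ => (k n : ℝ) / (n : ℝ)) atTop (𝓝 d))
    (hm : Tendsto (fun n : ℕ => (m n : ℝ) / (n : ℝ) ^ k n) atTop (𝓝 c)) :
    Tendsto m atTop atTop := by
  have hpow : Tendsto (fun n : ℕ => (n : ℝ) ^ k n) atTop atTop := by
    refine tendsto_atTop_mono' _ ?_ (tendsto_natCast_atTop_atTop (R := ℝ))
    filter_upwards [eventually_ge_atTop 1,
      (tendsto_natCast_of_div hd hk).eventually_ge_atTop 1] with n hn hkn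
    exact le_self_pow₀ (by exact_mod_cast hn) (by omega)
  refine tendsto_natCast_atTop_iff (R := ℝ).1 ((hm.pos_mul_atTop hc hpow).congr' ?_)
  filter_upwards [eventually_ge_atTop 1] with n hn
  exact div_mul_cancel₀ _ (by positivity)

theorem tendsto_sum_injections_div {τ mτ : ℕ → ℝ}
    (hτ : ∀ q : ℕ, 1 ≤ q → Tendsto (fun N : ℕ => (1 / (N : ℝ)) * ∑ j ∈ Finset.range N, τ j ^ q)
      atTop (𝓝 (mτ q))) (hm_atTop : Tendsto m atTop atTop)
    (hm : Tendsto (fun n : ℕ => (m n : ℝ) / (n : ℝ) ^ k n) atTop (𝓝 c))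
    {s : ℕ} (q : Fin s → ℕ) (hq : ∀ t, 1 ≤ q t) :
    Tendsto (fun n => (∑ φ ∈ injections s (m n), ∏ t, τ (φ t) ^ q t) / ((n : ℝ) ^ k n) ^ s) atTop
      (𝓝 (c ^ s * ∏ t, mτ (q t))) := by
  refine ((hm.pow s).mul ((tendsto_sum_injections hτ s q hq).comp hm_atTop)).congr' ?_
  filter_upwards [hm_atTop.eventually_ge_atTop 1] with n hn
  have hm0 : (m n : ℝ) ≠ 0 := Nat.cast_ne_zero.2 (by omega)
  simp only [Function.comp_apply]
  rw [div_pow, div_mul_div_comm, mul_comm, mul_div_mul_right _ _ (pow_ne_zero s hm0)]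

/-- Extension by zero to all canonical sequences allows a termwise comparison with the expectation.
-/
theorem coe_limitMoment (c d m₄ : ℝ) (mτ : ℕ → ℝ) {p : ℕ} (hp : 1 ≤ p)
    [∀ s, DecidablePred fun α : Fin p → Fin s => α ∈ canonicalOne s p] :
    (limitMoment c d m₄ mτ p : ℂ) =
      ∑ s ∈ Finset.range (p + 1), ∑ α ∈ canonicalAll s p,
        ((c ^ s * ∏ t, mτ (deg α t) : ℝ) : ℂ) * if α ∈ canonicalOne s p then
          Complex.exp (d * (((m₄ : ℂ) - 1) * ∑ t, ((deg α t).choose 2 : ℂ))) else 0 := by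
  rw [limitMoment, Complex.ofReal_sum]
  have hsub : Finset.Icc 1 p ⊆ Finset.range (p + 1) := fun s hs =>
    Finset.mem_range.2 (Nat.lt_succ_of_le (Finset.mem_Icc.1 hs).2)
  rw [← Finset.sum_subset hsub fun s hs hs' => ?_]
  · refine Finset.sum_congr rfl fun s _ => ?_
    have hsub' : canonicalOne s p ⊆ canonicalAll s p := fun α hα =>
      mem_canonicalAll.2 (mem_canonicalOne.1 hα).1
    rw [← Finset.sum_subset hsub' fun α _ hα => by rw [if_neg hα, mul_zero]]
    rw [Complex.ofReal_mul, Complex.ofReal_sum, Finset.mul_sum]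
    refine Finset.sum_congr rfl fun α hα => ?_
    rw [if_pos hα]
    push_cast
    rw [mul_assoc, mul_assoc]
  · refine Finset.sum_eq_zero fun α hα => ?_
    have h1 := (mem_canonicalAll.1 hα).one_le hp
    have h2 := Finset.mem_range.1 hs
    exact absurd (Finset.mem_Icc.2 ⟨h1, by omega⟩) hs'

end Limits

theorem one_le_deg {p s : ℕ} {α : Fin p → Fin s} (h : α.Surjective) (t : Fin s) :
    1 ≤ deg α t := by
  obtain ⟨u, rfl⟩ := h t
  exact Finset.card_pos.2 ⟨u, by simp⟩

end TensorCovariance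

open TensorCovariance in
theorem mainTheorem1
    {Ω : Type*} [MeasurableSpace Ω] (P : Measure Ω) [IsProbabilityMeasure P]
    -- the law of the base variable `ξ`: centered, unit variance, finite moments of all orders
    (μ : Measure ℂ) [IsProbabilityMeasure μ]
    (hmean : ∫ z, z ∂μ = 0) (hvar : ∫ z, ‖z‖ ^ 2 ∂μ = 1)
    (hmom : ∀ q : ℕ, Integrable (fun z : ℂ => ‖z‖ ^ q) μ)
    -- the regime `k / n → d`, `m / n ^ k → c`
    (k m : ℕ → ℕ) (c d : ℝ) (hc : 0 < c) (hd : 0 < d)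
    (hk : Tendsto (fun n : ℕ => (k n : ℝ) / (n : ℝ)) atTop (𝓝 d))
    (hm : Tendsto (fun n : ℕ => (m n : ℝ) / (n : ℝ) ^ k n) atTop (𝓝 c))
    -- for every `n` the entries are i.i.d. with law `μ`; nothing is assumed between different `n`
    (ξ : (n : ℕ) → Fin (m n) → Fin (k n) → Fin n → Ω → ℂ)
    (hlaw : ∀ n α l i, HasLaw (ξ n α l i) μ P)
    (hindep : ∀ n, iIndepFun
      (fun j : Fin (m n) × Fin (k n) × Fin n => ξ n j.1 j.2.1 j.2.2) P)
    -- the coefficients, whose empirical moments converge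
    (τ : ℕ → ℝ) (mτ : ℕ → ℝ)
    (hτ : ∀ q : ℕ, 1 ≤ q →
      Tendsto (fun N : ℕ => (1 / (N : ℝ)) * ∑ j ∈ Finset.range N, τ j ^ q) atTop (𝓝 (mτ q)))
    (p : ℕ) (hp : 1 ≤ p) :
    (∀ n, MemLp (fun ω => TensorCovariance.traceMoment τ p (fun α l i => ξ n α l i ω)) 2 P) ∧
    Tendsto
      (fun n => ∫ ω, TensorCovariance.traceMoment τ p (fun α l i => ξ n α l i ω) ∂P)
      atTop (𝓝 (TensorCovariance.limitMoment c d (∫ z, ‖z‖ ^ 4 ∂μ) mτ p)) ∧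
    Summable
      (fun n => Var[fun ω => TensorCovariance.traceMoment τ p (fun α l i => ξ n α l i ω); P]) ∧
    ∀ᵐ ω ∂P, Tendsto
      (fun n => TensorCovariance.traceMoment τ p (fun α l i => ξ n α l i ω))
      atTop (𝓝 (TensorCovariance.limitMoment c d (∫ z, ‖z‖ ^ 4 ∂μ) mτ p)) := by
  classical
  have hκ := isStandardMoments_mixedMoment hmean hvar
  have hξ (n : ℕ) (α l i) : HasMoments P (ξ n α l i) := hasMoments_of_hasLaw (hlaw n α l i) hmom
  have hk_atTop := tendsto_natCast_of_div hd hk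
  have hm_atTop := tendsto_natCast_size hc hd hk hm
  have hL2 (n : ℕ) := memLp_traceMoment (hξ n) τ hp
  have hE : Tendsto (fun n => ∫ ω, traceMoment τ p (fun α l i => ξ n α l i ω) ∂P)
      atTop (𝓝 (limitMoment c d (∫ z, ‖z‖ ^ 4 ∂μ) mτ p)) := by
    have hC : Tendsto
        (fun n => ((∫ ω, traceMoment τ p (fun α l i => ξ n α l i ω) ∂P : ℝ) : ℂ))
        atTop (𝓝 (limitMoment c d (∫ z, ‖z‖ ^ 4 ∂μ) mτ p : ℂ)) := by
      rw [coe_limitMoment _ _ _ _ hp, ← mixedMoment_two_two]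
      refine Tendsto.congr' (EventuallyEq.symm ?_) (tendsto_finsetSum _ fun s _ =>
        tendsto_finsetSum _ fun α hα => Tendsto.mul
          ((Complex.continuous_ofReal.tendsto _).comp (tendsto_sum_injections_div hτ hm_atTop hm
            (deg α) (one_le_deg (mem_canonicalAll.1 hα).1)))
          (tendsto_wordSum_pow hκ hd hk hp (mem_canonicalAll.1 hα)))
      filter_upwards [eventually_ge_atTop 1] with n hn
      exact coe_integral_traceMoment hmom (hlaw n) (hindep n) τ hp hκ hn
    exact (Complex.continuous_re.tendsto _).comp hC
  have hV : Summable
      (fun n => Var[fun ω => traceMoment τ p (fun α l i => ξ n α l i ω); P]) := by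
    obtain ⟨K, hK⟩ := hκ.exists_momentBound (p + p)
    obtain ⟨B₀, hB₀⟩ := hm.bddAbove_range
    obtain ⟨C, hC0, hC⟩ := exists_sum_prod_abs_mul_pow_le (exists_sum_abs_pow_le hτ)
      (Fin p ⊕ Fin p) B₀
    set L : ℝ := (K ^ (2 * (p + p)) * ((p + p : ℕ) + 1) ^ (p + p)) ^ 2
    have hL : 0 ≤ L := sq_nonneg _
    have hLn : Tendsto (fun n : ℕ => L / (n : ℝ)) atTop (𝓝 0) :=
      tendsto_const_div_atTop_nhds_zero_nat L
    -- The variance is at most `2 * C * (L / n) ^ k n`; once `k n ≥ 2` and `L ≤ n`, the exponent may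
    -- be lowered to 2.
    refine Summable.of_norm_bounded_eventually_nat (g := fun n : ℕ => 2 * C * L ^ 2 * (1 / (n : ℝ) ^ 2))
      ((Real.summable_one_div_nat_pow.2 one_lt_two).mul_left _) ?_
    filter_upwards [eventually_ge_atTop 1, hk_atTop.eventually_ge_atTop 2,
      hLn.eventually_le_const one_pos] with n hn hkn hLn1
    have hn0 : (0 : ℝ) < n := by exact_mod_cast hn
    rw [← Complex.norm_real, variance_traceMoment (hξ n) τ hp, norm_div, norm_pow, norm_pow,
      Complex.norm_natCast]
    have h1 := norm_integral_trace_sq_sub_le hmom (hlaw n) (hindep n) τ hp hκ hK hn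
    have h2 := hC (m n) (((n : ℝ) ^ k n)⁻¹) (by positivity)
      (by rw [← div_eq_mul_inv]; exact hB₀ ⟨n, rfl⟩)
    calc _ ≤ 2 * (L * n) ^ k n * C / ((n : ℝ) ^ k n) ^ 2 :=
          div_le_div_of_nonneg_right
            (h1.trans (mul_le_mul_of_nonneg_left h2 (by positivity))) (by positivity)
      _ = 2 * C * (L / n) ^ k n := by
          rw [mul_pow, div_pow]
          field_simp
      _ ≤ 2 * C * (L / n) ^ 2 :=
          mul_le_mul_of_nonneg_left (pow_le_pow_of_le_one (by positivity) hLn1 hkn) (by positivity)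
      _ = _ := by
          rw [div_pow]
          ring
  exact ⟨hL2, hE, hV, ae_tendsto_of_summable_variance hL2 hE hV⟩
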